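/- Let $n\ge 1$ and $k\ge 0$ be integers. An increasing tableau of shape $\lambda$ is a filling of the Young diagram of $\lambda$ by positive integers, strictly increasing along rows and down columns, whose set of entries is $\{1,\dots,M\}$ for some $M$. Let $\mathrm{Inc}^{2\times n}_k$ be the set of increasing tableaux of shape $2\times n$ (two rows of length $n$) with maximum entry $2n-k$. For an increasing tableau $T$ with maximum entry $M$, its K-promotion $\mathcal P(T)$ is defined as follows. Delete the entry $1$, leaving an empty box. Repeatedly, and simultaneously for all empty boxes, label each empty box by the minimal label of its SE-neighbors (the boxes immediately right of it and immediately below it) and remove that label from those SE-neighbors in which it appears; an empty box without labelled SE-neighbors is unchanged. When no empty box has a labelled SE-neighbor, label all empty boxes by $M+1$ and subtract $1$ from every label. Write $[T]_j$ for the set of boxes of $T$ with entry at most $j$. The K-evacuation $\mathcal E(T)$ is the increasing tableau encoded by the chain $\big([\mathcal P^{M-j}(T)]_j\big)_{0\le j\le M}$, i.e. $[\mathcal E(T)]_j=[\mathcal P^{M-j}(T)]_j$ for $0\le j\le M$. Put $$f(q)=\frac{\binom{n-1}{k}_q\binom{2n-k}{n-k-1}_q}{[n-k]_q},$$ where $[m]_q=1+q+\cdots+q^{m-1}$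 and $\binom{a}{b}_q$ is the $q$-binomial coefficient; for $k\ge n$ put $f=0$. Theorem. $f$ is a polynomial with integer coefficients, K-evacuation defines an action of the cyclic group $\mathcal C_2=\{1,c\}$ on $\mathrm{Inc}^{2\times n}_k$ in which $c$ acts by $\mathcal E$, and the triple $(\mathrm{Inc}^{2\times n}_k,\mathcal C_2,f)$ exhibits the cyclic sieving phenomenon: $\mathrm{Inc}^{2\times n}_k$ is finite and for every integer $m$ the number of its elements fixed by $c^m$ is $f((-1)^m)$. In particular, the number of $T\in\mathrm{Inc}^{2\times n}_k$ with $\mathcal E(T)=T$ is $f(-1)$. -/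

import Mathlib

open Polynomial

namespace KTableau

/-! ### Increasing tableaux

Boxes of a Young diagram are pairs `(i, j)` (row, column), counted from `0`, with rows drawn from top
to bottom. As in Mathlib's `SemistandardYoungTableau`, a filling is a function `ℕ → ℕ → ℕ`, and a
tableau vanishes outside its shape. -/

/-- An increasing tableau of shape `μ`: a semistandard tableau whose rows (and columns) are
strictly increasing and whose set of entries is an initial segment `{1, …, M}` of the positive
integers. -/
structure IncreasingTableau (μ : YoungDiagram) extends SemistandardYoungTableau μ where
  row_strict' : ∀ {i j1 j2 : ℕ}, j1 < j2 → (i, j2) ∈ μ → entry i j1 < entry i j2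
  entries_initial' : ∃ M : ℕ, {x : ℕ | ∃ i j, (i, j) ∈ μ ∧ entry i j = x} = Set.Icc 1 M

/-- The largest entry of a filling of `μ` (`0` if `μ` is empty). -/
def maxEntry (μ : YoungDiagram) (T : ℕ → ℕ → ℕ) : ℕ :=
  μ.cells.sup fun c => T c.1 c.2

/-- The set of increasing tableaux of shape `μ` with largest entry `|μ| - k`
(an equation between integers, hence written without subtraction). -/
def Inc (μ : YoungDiagram) (k : ℕ) : Type :=
  {T : IncreasingTableau μ // maxEntry μ T.entry + k = μ.card}

/-- The `m × n` rectangle, with `m` rows and `n` columns. -/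
def rect (m n : ℕ) : YoungDiagram where
  cells := Finset.range m ×ˢ Finset.range n
  isLowerSet := by
    intro a b hba ha
    simp only [Finset.coe_product, Set.mem_prod, Finset.mem_coe, Finset.mem_range] at ha ⊢
    exact ⟨lt_of_le_of_lt hba.1 ha.1, lt_of_le_of_lt hba.2 ha.2⟩

/-! ### K-promotion

While K-promotion is performed some boxes are empty. A partially filled diagram is a function
`ℕ → ℕ → WithTop ℕ`; the value `⊤` means that there is no label there, which is the case for empty
boxes and for positions outside the diagram. -/

/-- The minimal label of the SE-neighbors of the box `(i, j)`, that is of the boxes immediately right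
of it and immediately below it; `⊤` if these carry no label. -/
def seMin (U : ℕ → ℕ → WithTop ℕ) (i j : ℕ) : WithTop ℕ :=
  min (U i (j + 1)) (U (i + 1) j)

/-- `(i', j')` is a SE-neighbor of `(i, j)`. -/
def IsSENeighbor (i j i' j' : ℕ) : Prop :=
  (i' = i ∧ j' = j + 1) ∨ (i' = i + 1 ∧ j' = j)

instance (i j i' j' : ℕ) : Decidable (IsSENeighbor i j i' j') := by
  unfold IsSENeighbor; infer_instance

/-- One simultaneous move of all empty boxes: every empty box receives the minimal label of its
SE-neighbors (and stays empty if there is none), and that label is removed from the SE-neighbors in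
which it appears. -/
def slide (μ : YoungDiagram) (U : ℕ → ℕ → WithTop ℕ) (i j : ℕ) : WithTop ℕ :=
  if (i, j) ∈ μ then
    if U i j = ⊤ then seMin U i j
    else if ∃ b ∈ μ.cells, IsSENeighbor b.1 b.2 i j ∧ U b.1 b.2 = ⊤ ∧ seMin U b.1 b.2 = U i j then ⊤
    else U i j
  else ⊤

/-- Delete the entry `1` of `T`, leaving empty boxes. -/
def deleteOne (μ : YoungDiagram) (T : ℕ → ℕ → ℕ) (i j : ℕ) : WithTop ℕ :=
  if (i, j) ∈ μ ∧ T i j ≠ 1 then (T i j : WithTop ℕ) else ⊤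

/-- K-promotion: delete the entry `1`; move the empty boxes until none of them has a labelled
SE-neighbor; label the remaining empty boxes by `M + 1`, where `M` is the largest entry; subtract one
from every label.

A move takes every empty box that can still move one antidiagonal further, so that nothing can move
after `|μ|` moves, and further moves change nothing. -/
def kPromotion (μ : YoungDiagram) (T : ℕ → ℕ → ℕ) (i j : ℕ) : ℕ :=
  if (i, j) ∈ μ then
    (((slide μ)^[μ.card] (deleteOne μ T)) i j).untopD (maxEntry μ T + 1) - 1
  else 0

/-! ### K-evacuation -/

/-- `[T]_j`: the boxes of `μ` whose entry in `T` is at most `j`. -/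
def sublevel (μ : YoungDiagram) (T : ℕ → ℕ → ℕ) (j : ℕ) : Finset (ℕ × ℕ) :=
  μ.cells.filter fun c => T c.1 c.2 ≤ j

/-- `S` is the K-evacuation of `T`: with `M` the largest entry of `T`, the increasing tableau `S` is
the one encoded by the chain `([P^(M - j)(T)]_j)` for `0 ≤ j ≤ M`, where `P` is K-promotion; that is,
`[S]_j = [P^(M - j)(T)]_j` for all these `j`. (For `j = M` this says that all entries of `S` are at
most `M`, so there is at most one such `S`.) -/
def IsKEvacuation {μ : YoungDiagram} (T S : IncreasingTableau μ) : Prop :=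
  ∀ j ≤ maxEntry μ T.entry,
    sublevel μ S.entry j =
      sublevel μ ((kPromotion μ)^[maxEntry μ T.entry - j] T.entry) j

/-! ### Cyclic sieving -/

/-- The cyclic sieving phenomenon for a finite set `X`, a finite cyclic group `C = ⟨c⟩` of order `n`
acting on `X`, and `f ∈ ℤ[q]`: for all `m`, the number of elements of `X` fixed by `c ^ m` is
`f (ζ ^ m)`, where `ζ` is any primitive `n`-th root of unity. -/
structure HasCyclicSieving (X : Type*) {C : Type*} [Group C] [MulAction C X] (c : C) (f : ℤ[X]) :
    Prop where
  finite_set : Finite X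
  finite_group : Finite C
  generates : ∀ g : C, g ∈ Subgroup.zpowers c
  card_fixed : ∀ (m : ℤ) (ζ : ℂ), IsPrimitiveRoot ζ (Nat.card C) →
    (Nat.card (MulAction.fixedBy X (c ^ m)) : ℂ) = aeval (ζ ^ m) f

/-! ### The polynomial -/

/-- The `q`-integer `[n]_q = 1 + q + ⋯ + q^(n-1)`. -/
noncomputable def qInt (n : ℕ) : ℤ[X] := ∑ i ∈ Finset.range n, X ^ i

/-- The `q`-factorial `[n]_q! = [1]_q [2]_q ⋯ [n]_q`. -/
noncomputable def qFactorial (n : ℕ) : ℤ[X] := ∏ i ∈ Finset.range n, qInt (i + 1)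

/-- The `q`-binomial coefficient, through the `q`-Pascal recursion; see
`qBinom_mul_qFactorial_mul_qFactorial` for the quotient formula. -/
noncomputable def qBinom : ℕ → ℕ → ℤ[X]
  | _, 0 => 1
  | 0, _ + 1 => 0
  | n + 1, k + 1 => qBinom n k + X ^ (k + 1) * qBinom n (k + 1)

theorem qBinom_eq_zero_of_lt : ∀ {n k : ℕ}, n < k → qBinom n k = 0
  | _, 0, h => absurd h (Nat.not_lt_zero _)
  | 0, _ + 1, _ => by rw [qBinom]
  | n + 1, k + 1, h => by
    rw [qBinom, qBinom_eq_zero_of_lt (by omega : n < k),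
      qBinom_eq_zero_of_lt (by omega : n < k + 1)]
    simp

theorem qInt_add (a b : ℕ) : qInt (a + b) = qInt a + X ^ a * qInt b := by
  simp [qInt, Finset.sum_range_add, Finset.mul_sum, pow_add]

/-- `[a+b choose a]_q [a]_q! [b]_q! = [a+b]_q!`. -/
theorem qBinom_mul_qFactorial_mul_qFactorial : ∀ a b : ℕ,
    qBinom (a + b) a * (qFactorial a * qFactorial b) = qFactorial (a + b)
  | 0, b => by simp [qBinom, qFactorial]
  | a + 1, 0 => by
    have h := qBinom_mul_qFactorial_mul_qFactorial a 0
    simp only [qFactorial, Finset.prod_range_succ, Nat.add_zero] at h ⊢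
    rw [qBinom, qBinom_eq_zero_of_lt (Nat.lt_succ_self a)]
    linear_combination (qInt (a + 1)) * h
  | a + 1, b + 1 => by
    have h1 := qBinom_mul_qFactorial_mul_qFactorial a (b + 1)
    have h2 := qBinom_mul_qFactorial_mul_qFactorial (a + 1) b
    have e : a + 1 + b = a + (b + 1) := by omega
    have e' : a + 1 + (b + 1) = a + (b + 1) + 1 := by omega
    have ha : qFactorial (a + 1) = qFactorial a * qInt (a + 1) := Finset.prod_range_succ _ _
    have hb : qFactorial (b + 1) = qFactorial b * qInt (b + 1) := Finset.prod_range_succ _ _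
    have hab : qFactorial (a + (b + 1) + 1) = qFactorial (a + (b + 1)) * qInt (a + 1 + (b + 1)) := by
      rw [e']; exact Finset.prod_range_succ _ _
    rw [e] at h2
    rw [e', qBinom, hab, qInt_add]
    rw [ha] at h2 ⊢
    rw [hb] at h1 ⊢
    linear_combination (qInt (a + 1)) * h1 + X ^ (a + 1) * qInt (b + 1) * h2

/-- `f(q) = [n-1 choose k]_q [2n-k choose n-k-1]_q / [n-k]_q`, as the quotient by the monic polynomial
`[n-k]_q` when `k < n`. When `1 ≤ n ≤ k` the numerator is `0`, and so is `f`. -/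
noncomputable def sievingPoly (n k : ℕ) : ℤ[X] :=
  (qBinom (n - 1) k * qBinom (2 * n - k) (n - k - 1)) /ₘ qInt (n - k)

end KTableau

namespace KTableau

/-! A tableau in $\mathrm{Inc}^{2\times n}_k$ is a lattice path of length $M=2n-k$: the step of $v$
is $1$, $-1$ or $0$ according to whether $v$ lies in the upper row only, the lower row only, or
both. Strictness of the columns says exactly that steps $0$ and $-1$ start at positive height. So
these tableaux correspond to the small Schröder words with $k$ flat steps that end at height $0$
(`Inc.word_injective`, `exists_word_eq_iff`).

K-evacuation is rotation by a half turn combined with $v\mapsto M+1-v$ (`isKEvacuation_iff`). The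
reason is a closed formula for all iterates of promotion. If $a$, $b$ count the entries $\le v$ in
the two rows of $T$, the counts at $v$ in the rows of $\mathcal P^s(T)$ are expressed, for $s+v\le
M$, by $a$, $b$ and minima of the path over the window $[s,s+v]$ (`rowCount_iterate_kPromotion`). On
the full window $[s,M]$ these minima are $0$, because the path ends at height $0$; the counts become
$n-b(s)$ and $n-a(s)$, which is the rotated complement of $[T]_s$
(`rowCount_iterate_kPromotion_sub`). Hence $\mathcal E$ is an involution, and on words it reverses
the order and negates the letters (`Inc.word_evacuate`).

A self-dual word is determined by its first half, which may be any small prefix; when $k$ is odd the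
middle letter is $0$, so that the prefix must end at positive height (`card_symmetricWords_even`,
`card_symmetricWords_odd`). It remains to compare two enumerations with $f(1)$ and $f(-1)$. The
counts of small words and of their prefixes follow from one reflection identity, `smallCount_add`.
On the other side `sievingPoly_eq` writes $f$ as a difference of products of $q$-binomials, which
proves integrality and can be evaluated directly at $\pm1$. -/

/-! ### The sieving polynomial and its values at 1 and −1. -/

theorem eval_one_qBinom : ∀ n k : ℕ, (qBinom n k).eval 1 = (n.choose k : ℤ)
  | n, 0 => by simp [qBinom]
  | 0, k + 1 => by simp [qBinom]
  | n + 1, k + 1 => by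
    simp [qBinom, eval_one_qBinom n k, eval_one_qBinom n (k + 1), Nat.choose_succ_succ]

/-- This is the $q$-Lucas theorem at $q=-1$: the value at $(2a+\varepsilon,2c+\delta)$ is $\binom
ac\binom\varepsilon\delta$. The passage from an even row to the next odd row is isolated because the
induction over even rows goes through it as well. -/
theorem eval_neg_one_qBinom_even_aux (a : ℕ)
    (h0 : ∀ c, (qBinom (2 * a) (2 * c)).eval (-1) = (a.choose c : ℤ))
    (h1 : ∀ c, (qBinom (2 * a) (2 * c + 1)).eval (-1) = 0) :
    (∀ c, (qBinom (2 * a + 1) (2 * c)).eval (-1) = (a.choose c : ℤ)) ∧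
      ∀ c, (qBinom (2 * a + 1) (2 * c + 1)).eval (-1) = (a.choose c : ℤ) := by
  constructor
  · rintro (_ | c)
    · simp [qBinom]
    · have h0' := h0 (c + 1)
      rw [show 2 * (c + 1) = 2 * c + 1 + 1 by ring] at h0' ⊢
      simp [qBinom, h1, h0', pow_succ, pow_mul]
  · intro c
    simp [qBinom, h0, h1]

theorem eval_neg_one_qBinom_even (a : ℕ) :
    (∀ c, (qBinom (2 * a) (2 * c)).eval (-1) = (a.choose c : ℤ)) ∧
      ∀ c, (qBinom (2 * a) (2 * c + 1)).eval (-1) = 0 := by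
  induction a with
  | zero =>
    constructor
    · rintro (_ | c)
      · simp [qBinom]
      · rw [qBinom_eq_zero_of_lt (by omega)]; simp
    · intro c
      rw [qBinom_eq_zero_of_lt (by omega)]; simp
  | succ a ih =>
    obtain ⟨h0, h1⟩ := eval_neg_one_qBinom_even_aux a ih.1 ih.2
    rw [show 2 * (a + 1) = 2 * a + 1 + 1 by ring]
    constructor
    · rintro (_ | c)
      · simp [qBinom]
      · have h0' := h0 (c + 1)
        rw [show 2 * (c + 1) = 2 * c + 1 + 1 by ring] at h0' ⊢
        rw [qBinom]; simp [h1, h0', pow_succ, pow_mul, Nat.choose_succ_succ]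
    · intro c
      rw [qBinom]; simp [h0, h1, pow_succ, pow_mul]

theorem eval_neg_one_qBinom_odd (a : ℕ) :
    (∀ c, (qBinom (2 * a + 1) (2 * c)).eval (-1) = (a.choose c : ℤ)) ∧
      ∀ c, (qBinom (2 * a + 1) (2 * c + 1)).eval (-1) = (a.choose c : ℤ) :=
  eval_neg_one_qBinom_even_aux a (eval_neg_one_qBinom_even a).1 (eval_neg_one_qBinom_even a).2

theorem qInt_succ_monic (m : ℕ) : (qInt (m + 1)).Monic :=
  monic_geom_sum_X (Nat.succ_ne_zero m)

theorem qInt_succ (m : ℕ) : qInt (m + 1) = 1 + X * qInt m := by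
  rw [add_comm, qInt_add]; simp [qInt]

theorem qFactorial_succ (m : ℕ) : qFactorial (m + 1) = qFactorial m * qInt (m + 1) :=
  Finset.prod_range_succ _ _

theorem qFactorial_ne_zero (m : ℕ) : qFactorial m ≠ 0 :=
  Finset.prod_ne_zero_iff.2 fun i _ => (qInt_succ_monic i).ne_zero

theorem qBinom_succ_mul_qInt (k m : ℕ) :
    qBinom (k + m + 1) k * qInt (m + 1) = qInt (k + m + 1) * qBinom (k + m) k := by
  have h1 := qBinom_mul_qFactorial_mul_qFactorial k (m + 1)
  have h2 := qBinom_mul_qFactorial_mul_qFactorial k m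
  rw [← add_assoc, qFactorial_succ, qFactorial_succ] at h1
  refine mul_right_cancel₀ (mul_ne_zero (qFactorial_ne_zero k) (qFactorial_ne_zero m)) ?_
  linear_combination h1 - qInt (k + m + 1) * h2

theorem qBinom_mul_qInt_right (a b : ℕ) :
    qBinom (a + b + 1) a * qInt (b + 1) = qBinom (a + b + 1) (a + 1) * qInt (a + 1) := by
  have h1 := qBinom_mul_qFactorial_mul_qFactorial a (b + 1)
  have h2 := qBinom_mul_qFactorial_mul_qFactorial (a + 1) b
  rw [← add_assoc, qFactorial_succ] at h1
  rw [show a + 1 + b = a + b + 1 by ring, qFactorial_succ a] at h2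
  refine mul_right_cancel₀ (mul_ne_zero (qFactorial_ne_zero a) (qFactorial_ne_zero b)) ?_
  linear_combination h1 - h2

/-- The numerator `N` of the sieving polynomial satisfies `[n]_q N, [n+1]_q N ∈ ([n-k]_q)`, and
`[n+1]_q - q [n]_q = 1`. -/
theorem sieving_numerator_eq (k m : ℕ) :
    qBinom (k + m) k * qBinom (k + 2 * m + 2) m =
      qInt (m + 1) * (qBinom (k + m) k * qBinom (k + 2 * m + 2) (m + 1) -
        X * (qBinom (k + m + 1) k * qBinom (k + 2 * m + 2) m)) := by
  have h1 := qBinom_succ_mul_qInt k m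
  have h2 := qBinom_mul_qInt_right m (k + m + 1)
  rw [show m + (k + m + 1) + 1 = k + 2 * m + 2 by ring] at h2
  have h3 := qInt_succ (k + m + 1)
  linear_combination (qBinom (k + m) k) * h2 + X * qBinom (k + 2 * m + 2) m * h1 -
    qBinom (k + m) k * qBinom (k + 2 * m + 2) m * h3

theorem sievingPoly_eq (k m : ℕ) :
    sievingPoly (k + m + 1) k = qBinom (k + m) k * qBinom (k + 2 * m + 2) (m + 1) -
        X * (qBinom (k + m + 1) k * qBinom (k + 2 * m + 2) m) := by
  rw [sievingPoly, show k + m + 1 - 1 = k + m by omega,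
    show 2 * (k + m + 1) - k = k + 2 * m + 2 by omega, show k + m + 1 - k - 1 = m by omega,
    show k + m + 1 - k = m + 1 by omega, sieving_numerator_eq,
    mul_divByMonic_cancel_left _ (qInt_succ_monic m)]

theorem sievingPoly_eq_zero {n k : ℕ} (hn : 1 ≤ n) (h : n ≤ k) : sievingPoly n k = 0 := by
  rw [sievingPoly, qBinom_eq_zero_of_lt (by omega : n - 1 < k)]; simp

theorem sievingPoly_mul_qInt (n k : ℕ) (hn : 1 ≤ n) :
    sievingPoly n k * qInt (n - k) = qBinom (n - 1) k * qBinom (2 * n - k) (n - k - 1) := by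
  rcases le_or_gt n k with h | h
  · rw [sievingPoly_eq_zero hn h, qBinom_eq_zero_of_lt (by omega : n - 1 < k)]; simp
  · obtain ⟨m, rfl⟩ := Nat.exists_eq_add_of_lt h
    rw [sievingPoly_eq, show k + m + 1 - 1 = k + m by omega,
      show 2 * (k + m + 1) - k = k + 2 * m + 2 by omega, show k + m + 1 - k - 1 = m by omega,
      show k + m + 1 - k = m + 1 by omega, sieving_numerator_eq, mul_comm]

theorem eval_one_sievingPoly (k m : ℕ) :
    (sievingPoly (k + m + 1) k).eval 1 = ((k + m).choose k * (k + 2 * m + 2).choose (m + 1) -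
      (k + m + 1).choose k * (k + 2 * m + 2).choose m : ℤ) := by
  simp [sievingPoly_eq, eval_one_qBinom]

/-- In this and the next three parity cases exactly one of the two products in `sievingPoly_eq`
contains an odd-index $q$-binomial from an even row, and so vanishes at $-1$. The other product
gives the value. -/
theorem eval_neg_one_sievingPoly_even_even (b c : ℕ) :
    (sievingPoly (2 * b + 2 * c + 1) (2 * b)).eval (-1) =
      ((b + c).choose b * (b + 2 * c + 1).choose c : ℤ) := by
  rw [sievingPoly_eq, show 2 * b + 2 * c = 2 * (b + c) by ring,
    show 2 * b + 2 * (2 * c) + 2 = 2 * (b + 2 * c + 1) by ring]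
  simp [eval_neg_one_qBinom_even, eval_neg_one_qBinom_odd]

theorem eval_neg_one_sievingPoly_even_odd (b c : ℕ) :
    (sievingPoly (2 * b + (2 * c + 1) + 1) (2 * b)).eval (-1) =
      ((b + c).choose b * (b + 2 * c + 2).choose (c + 1) : ℤ) := by
  rw [sievingPoly_eq, show 2 * b + (2 * c + 1) = 2 * (b + c) + 1 by ring,
    show 2 * b + 2 * (2 * c + 1) + 2 = 2 * (b + 2 * c + 2) by ring,
    show 2 * c + 1 + 1 = 2 * (c + 1) by ring]
  simp [eval_neg_one_qBinom_even, eval_neg_one_qBinom_odd]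

theorem eval_neg_one_sievingPoly_odd_even (b c : ℕ) :
    (sievingPoly (2 * b + 1 + 2 * c + 1) (2 * b + 1)).eval (-1) =
      ((b + c).choose b * (b + 2 * c + 1).choose c : ℤ) := by
  rw [sievingPoly_eq, show 2 * b + 1 + 2 * c + 1 = 2 * (b + c + 1) by ring,
    show 2 * b + 1 + 2 * c = 2 * (b + c) + 1 by ring,
    show 2 * b + 1 + 2 * (2 * c) + 2 = 2 * (b + 2 * c + 1) + 1 by ring]
  simp [eval_neg_one_qBinom_even, eval_neg_one_qBinom_odd]

theorem eval_neg_one_sievingPoly_odd_odd (b c : ℕ) :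
    (sievingPoly (2 * b + 1 + (2 * c + 1) + 1) (2 * b + 1)).eval (-1) =
      ((b + c + 1).choose b * (b + 2 * c + 2).choose c : ℤ) := by
  rw [sievingPoly_eq, show 2 * b + 1 + (2 * c + 1) + 1 = 2 * (b + c + 1) + 1 by ring,
    show 2 * b + 1 + (2 * c + 1) = 2 * (b + c + 1) by ring,
    show 2 * b + 1 + 2 * (2 * c + 1) + 2 = 2 * (b + 2 * c + 2) + 1 by ring]
  simp [eval_neg_one_qBinom_even, eval_neg_one_qBinom_odd]

/-! ### Counting lattice words -/

/-- The height reached by a word of steps `1`, `0`, `-1`. -/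
def height : List SignType → ℤ
  | [] => 0
  | x :: w => height w + x

/-- Words, read from right to left, in which every step `0` or `-1` starts at positive height: these
are the prefixes of small Schröder paths. -/
def IsSmall : List SignType → Prop
  | [] => True
  | x :: w => IsSmall w ∧ (x ≠ 1 → 0 < height w)

/-- The small words of length `L`. -/
def smallWords : ℕ → Finset (List SignType)
  | 0 => {[]}
  | L + 1 =>
    (smallWords L).map ⟨List.cons 1, List.cons_injective⟩ ∪
      (((smallWords L).filter (0 < height ·)).map ⟨List.cons 0, List.cons_injective⟩ ∪
        ((smallWords L).filter (0 < height ·)).map ⟨List.cons (-1), List.cons_injective⟩)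

theorem mem_smallWords {L : ℕ} {w : List SignType} :
    w ∈ smallWords L ↔ w.length = L ∧ IsSmall w := by
  induction L generalizing w with
  | zero =>
    simp only [smallWords, Finset.mem_singleton, List.length_eq_zero_iff]
    exact ⟨fun h => by simp [h, IsSmall], fun h => h.1⟩
  | succ L ih =>
    rcases w with _ | ⟨x, w⟩
    · simp [smallWords]
    · cases x <;> simp [smallWords, ih, IsSmall, and_assoc]

theorem IsSmall.height_nonneg : ∀ {w : List SignType}, IsSmall w → 0 ≤ height w
  | [], _ => le_rfl
  | x :: w, h => by
    have := h.1.height_nonneg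
    have h2 := h.2
    cases x <;> simp [height] at h2 ⊢ <;> omega

theorem height_le_length : ∀ w : List SignType, height w ≤ w.length
  | [] => le_rfl
  | x :: w => by
    have := height_le_length w
    cases x <;> simp [height] <;> omega

/-- The number of small words of length `L` with `b` steps `0` whose height is `h`. -/
def smallCount (L : ℕ) (b h : ℤ) : ℤ :=
  ((smallWords L).filter fun w => (w.count 0 : ℤ) = b ∧ height w = h).card

theorem card_filter_smallWords_succ (L : ℕ) (p : List SignType → Prop) [DecidablePred p] :
    ((smallWords (L + 1)).filter p).card =
      ((smallWords L).filter fun w => p (1 :: w)).card +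
      (((smallWords L).filter fun w => 0 < height w ∧ p (0 :: w)).card +
      ((smallWords L).filter fun w => 0 < height w ∧ p (-1 :: w)).card) := by
  have h1 : (1 : SignType) ≠ 0 := by decide
  have h2 : (1 : SignType) ≠ -1 := by decide
  have h3 : (0 : SignType) ≠ -1 := by decide
  rw [smallWords, Finset.filter_union, Finset.card_union_of_disjoint, Finset.filter_union,
    Finset.card_union_of_disjoint]
  · simp [Finset.filter_map, Finset.filter_filter]
  all_goals
    simp only [Finset.disjoint_left, Finset.mem_filter, Finset.mem_map, Finset.mem_union,
      Function.Embedding.coeFn_mk]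
    grind

theorem smallCount_eq_zero_of_zeros_neg (L : ℕ) {b : ℤ} (h : ℤ) (hb : b < 0) :
    smallCount L b h = 0 := by
  simp only [smallCount, Nat.cast_eq_zero, Finset.card_eq_zero, Finset.filter_eq_empty_iff]
  rintro w - ⟨h, -⟩
  omega

theorem smallCount_zero (b h : ℤ) : smallCount 0 b h = if b = 0 ∧ h = 0 then 1 else 0 := by
  have : ((0 : ℤ) = b ∧ 0 = h) ↔ (b = 0 ∧ h = 0) := by omega
  simp only [smallCount, smallWords, Finset.filter_singleton, List.count_nil, height,
    Nat.cast_zero, this]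
  split_ifs <;> simp

theorem smallCount_succ (L : ℕ) (b : ℤ) {h : ℤ} (hh : 0 < h) :
    smallCount (L + 1) b h =
      smallCount L b (h - 1) + smallCount L b (h + 1) + smallCount L (b - 1) h := by
  have e1 : ((smallWords L).filter fun w =>
      (((1 :: w : List SignType).count 0 : ℕ) : ℤ) = b ∧ height (1 :: w) = h) =
      (smallWords L).filter fun w => (w.count 0 : ℤ) = b ∧ height w = h - 1 :=
    Finset.filter_congr fun w _ => by simp [height]; omega
  have e2 : ((smallWords L).filter fun w => 0 < height w ∧
      (((0 :: w : List SignType).count 0 : ℕ) : ℤ) = b ∧ height (0 :: w) = h) =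
      (smallWords L).filter fun w => (w.count 0 : ℤ) = b - 1 ∧ height w = h :=
    Finset.filter_congr fun w _ => by simp [height]; omega
  have e3 : ((smallWords L).filter fun w => 0 < height w ∧
      (((-1 :: w : List SignType).count 0 : ℕ) : ℤ) = b ∧ height (-1 :: w) = h) =
      (smallWords L).filter fun w => (w.count 0 : ℤ) = b ∧ height w = h + 1 :=
    Finset.filter_congr fun w _ => by simp [height]; omega
  simp only [smallCount]
  rw [card_filter_smallWords_succ, e1, e2, e3]
  push_cast
  ring

theorem smallCount_succ_zero (L : ℕ) (b : ℤ) : smallCount (L + 1) b 0 = smallCount L b 1 := by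
  simp only [smallCount]
  rw [card_filter_smallWords_succ, Nat.cast_inj]
  have e1 : ((smallWords L).filter fun w =>
      (((1 :: w : List SignType).count 0 : ℕ) : ℤ) = b ∧ height (1 :: w) = 0) = ∅ := by
    rw [Finset.filter_eq_empty_iff]
    rintro w hw ⟨-, h⟩
    have := (mem_smallWords.1 hw).2.height_nonneg
    simp [height] at h
    omega
  have e2 : ((smallWords L).filter fun w => 0 < height w ∧
      (((0 :: w : List SignType).count 0 : ℕ) : ℤ) = b ∧ height (0 :: w) = 0) = ∅ := by
    rw [Finset.filter_eq_empty_iff]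
    rintro w hw ⟨h0, -, h⟩
    simp [height] at h
    omega
  rw [e1, e2]
  simp only [Finset.card_empty, zero_add]
  congr 1
  refine Finset.filter_congr fun w _ => ?_
  simp [height]
  omega

/-- The number of all words of length `L` with `b` steps `0` whose height is `h`. -/
def wordCount : ℕ → ℤ → ℤ → ℤ
  | 0, b, h => if b = 0 ∧ h = 0 then 1 else 0
  | L + 1, b, h => wordCount L b (h - 1) + wordCount L b (h + 1) + wordCount L (b - 1) h

theorem wordCount_neg (L : ℕ) (b h : ℤ) : wordCount L b (-h) = wordCount L b h := by
  induction L generalizing b h with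
  | zero => simp [wordCount]
  | succ L ih =>
    rw [wordCount, wordCount, ih, show -h - 1 = -(h + 1) by ring, show -h + 1 = -(h - 1) by ring,
      ih, ih]
    ring

theorem wordCount_eq_zero (L : ℕ) (b h : ℤ) (H : b < 0 ∨ L < b + |h|) : wordCount L b h = 0 := by
  induction L generalizing b h with
  | zero =>
    rw [wordCount, if_neg]
    rintro ⟨rfl, rfl⟩
    simp at H
  | succ L ih =>
    push_cast at H
    rw [wordCount, ih, ih, ih]
    · rfl
    all_goals grind

/-- The trinomial coefficient: place the $d$ down steps, then the $b$ flat steps among the remaining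
$u+b$ positions. -/
theorem wordCount_eq (u d b : ℕ) :
    wordCount (u + d + b) b (u - d) = ((u + b).choose b * (u + d + b).choose d : ℤ) := by
  induction hL : u + d + b generalizing u d b with
  | zero =>
    obtain ⟨⟨rfl, rfl⟩, rfl⟩ : (u = 0 ∧ d = 0) ∧ b = 0 := by omega
    simp [wordCount]
  | succ L ih =>
    have eu : wordCount L b (u - d - 1) =
        (if u = 0 then 0 else (u - 1 + b).choose b * L.choose d : ℕ) := by
      rcases u with _ | u
      · rw [wordCount_eq_zero]
        · simp
        · right
          rw [abs_of_nonpos] <;> push_cast <;> omega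
      · rw [show ((u + 1 : ℕ) : ℤ) - d - 1 = u - d by push_cast; ring, ih u d b (by omega)]
        simp
    have ed : wordCount L b (u - d + 1) =
        (if d = 0 then 0 else (u + b).choose b * L.choose (d - 1) : ℕ) := by
      rcases d with _ | d
      · rw [wordCount_eq_zero]
        · simp
        · right
          rw [abs_of_nonneg] <;> push_cast <;> omega
      · rw [show (u : ℤ) - (d + 1 : ℕ) + 1 = u - d by push_cast; ring, ih u d b (by omega)]
        simp
    have eb : wordCount L (b - 1) (u - d) =
        (if b = 0 then 0 else (u + (b - 1)).choose (b - 1) * L.choose d : ℕ) := by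
      rcases b with _ | b
      · rw [wordCount_eq_zero]
        · simp
        · left; simp
      · rw [show ((b + 1 : ℕ) : ℤ) - 1 = b by push_cast; ring, ih u d b (by omega)]
        simp
    rw [wordCount, eu, ed, eb]
    norm_cast
    -- Pascal's rule for $\binom{u+b}{b}$ fails only at $u=b=0$, where all steps are down steps;
    -- that case is treated apart.
    have h1 : (u + b).choose b * L.choose d = (if u = 0 then 0 else (u - 1 + b).choose b * L.choose d)
        + (if b = 0 then 0 else (u + (b - 1)).choose (b - 1) * L.choose d) ∨ (u = 0 ∧ b = 0) := by
      rcases u with _ | u <;> rcases b with _ | b <;> simp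
      rw [show u + 1 + (b + 1) = u + b + 1 + 1 by ring, Nat.choose_succ_succ (u + b + 1) b,
        show u + (b + 1) = u + b + 1 by ring, show u + 1 + b = u + b + 1 by ring]
      ring
    rcases h1 with h1 | ⟨rfl, rfl⟩
    · rcases d with _ | d
      · simp at h1 ⊢
        rw [h1]
      · simp at h1 ⊢
        rw [Nat.choose_succ_succ L d, mul_add, h1]
        ring
    · obtain rfl : d = L + 1 := by omega
      simp

/-- Both sides count the words that stay at height $\ge 0$ and may have flat steps at height $0$.
The right side is the reflection principle. For the left side, such a word is either small, or its
first flat step at height $0$ can be turned into an up step, giving a small word with one flat step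
less that ends one higher. The proof checks that both sides satisfy the same recursion; at the
boundary $h=0$ the symmetry `wordCount_neg` supplies the missing term. -/
theorem smallCount_add (L : ℕ) (b h : ℤ) (hh : 0 ≤ h) :
    smallCount L b h + smallCount L (b - 1) (h + 1) = wordCount L b h - wordCount L b (h + 2) := by
  induction L generalizing b h with
  | zero =>
    rw [smallCount_zero, smallCount_zero, wordCount, wordCount,
      if_neg (by omega : ¬(b - 1 = 0 ∧ h + 1 = 0)), if_neg (by omega : ¬(b = 0 ∧ h + 2 = 0))]
    ring
  | succ L ih =>
    rcases hh.eq_or_lt with rfl | hh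
    · have h1 := ih b 1 (by norm_num)
      have h2 := ih (b - 1) 0 le_rfl
      have h3 := wordCount_neg L b 1
      rw [smallCount_succ_zero, smallCount_succ L (b - 1) (by norm_num), wordCount, wordCount]
      norm_num at h1 h2 h3 ⊢
      linarith
    · have h1 := ih b (h - 1) (by omega)
      have h2 := ih b (h + 1) (by omega)
      have h3 := ih (b - 1) h (by omega)
      rw [smallCount_succ L b hh, smallCount_succ L (b - 1) (by omega), wordCount, wordCount]
      rw [show h - 1 + 1 = h by ring, show h - 1 + 2 = h + 1 by ring] at h1
      rw [show h + 1 + 1 = h + 2 by ring] at h2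
      rw [show h + 1 - 1 = h by ring, show h + 1 + 1 = h + 2 by ring, show h + 2 - 1 = h + 1 by ring]
      rw [show h + 1 + 2 = h + 2 + 1 by ring] at h2
      linarith

/-- The number of small Schröder paths with `k` flat steps and `m + 1` up steps. -/
theorem smallCount_closed (k m : ℕ) :
    smallCount (k + 2 * m + 2) k 0 = ((k + m).choose k * (k + 2 * m + 2).choose (m + 1) -
      (k + m + 1).choose k * (k + 2 * m + 2).choose m : ℤ) := by
  have key (k m : ℕ) := smallCount_add (k + 2 * m + 2) k 0 le_rfl
  have w0 (k m : ℕ) := wordCount_eq (m + 1) (m + 1) k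
  have w2 (k m : ℕ) := wordCount_eq (m + 2) m k
  induction k generalizing m with
  | zero =>
    have := key 0 m
    have h0 := w0 0 m
    have h2 := w2 0 m
    rw [smallCount_eq_zero_of_zeros_neg _ (b := ((0 : ℕ) : ℤ) - 1) _ (by norm_num), add_zero] at this
    rw [show m + 1 + (m + 1) + 0 = 0 + 2 * m + 2 by ring, sub_self] at h0
    rw [show m + 2 + m + 0 = 0 + 2 * m + 2 by ring,
      show ((m + 2 : ℕ) : ℤ) - m = 0 + 2 by push_cast; ring] at h2
    rw [h0, h2] at this
    simpa using this
  | succ k ih =>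
    have := key (k + 1) m
    have h0 := w0 (k + 1) m
    have h2 := w2 (k + 1) m
    -- A small word of positive length ending at height $0$ ends with a down step. So the words
    -- ending at height $1$ in `smallCount_add` are those of length one more ending at $0$, which
    -- have $m+2$ up steps: hence the induction on $k$ with $m$ general.
    have h1 := ih (m + 1)
    rw [show k + 2 * (m + 1) + 2 = k + 1 + 2 * m + 2 + 1 by ring, smallCount_succ_zero] at h1
    rw [show m + 1 + (m + 1) + (k + 1) = k + 1 + 2 * m + 2 by ring] at h0
    rw [show m + 2 + m + (k + 1) = k + 1 + 2 * m + 2 by ring] at h2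
    rw [sub_self] at h0
    rw [show ((m + 2 : ℕ) : ℤ) - m = 0 + 2 by push_cast; ring] at h2
    rw [show ((k + 1 : ℕ) : ℤ) - 1 = k by push_cast; ring, zero_add, h1, h0, h2] at this
    rw [eq_sub_of_add_eq this]
    set L := k + 1 + 2 * m + 2 with hL
    rw [show m + 1 + (k + 1) = k + m + 1 + 1 by ring, show m + 2 + (k + 1) = k + m + 2 + 1 by ring,
      show k + (m + 1) = k + m + 1 by ring, show k + 1 + m = k + m + 1 by ring,
      show k + m + 1 + 1 = k + m + 2 by ring]
    have a1 : (k + m + 3).choose (k + 1) = (k + m + 2).choose k + (k + m + 2).choose (k + 1) :=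
      Nat.choose_succ_succ _ _
    have a2 : (k + m + 2).choose (k + 1) = (k + m + 1).choose k + (k + m + 1).choose (k + 1) :=
      Nat.choose_succ_succ _ _
    have a3 : (L + 1).choose (m + 1 + 1) = L.choose (m + 1) + L.choose (m + 1 + 1) :=
      Nat.choose_succ_succ _ _
    have a4 : (L + 1).choose (m + 1) = L.choose m + L.choose (m + 1) :=
      Nat.choose_succ_succ _ _
    have b1 : (k + m + 2).choose k * (m + 2) = (k + m + 2) * (k + m + 1).choose k := by
      have := Nat.add_one_mul_choose_eq (k + m + 1) (m + 1)
      have e1 := Nat.choose_symm_add (a := k) (b := m + 1)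
      have e2 := Nat.choose_symm_add (a := k) (b := m + 2)
      simp only [← add_assoc] at e1 e2 
      rw [e1, e2]
      linarith
    have b2 : L.choose (m + 1) * (k + m + 2) = L.choose (m + 2) * (m + 2) := by
      have := Nat.choose_succ_right_eq L (m + 1)
      rw [this]
      congr 1
      omega
    have b : (k + m + 1).choose k * L.choose (m + 2) = (k + m + 2).choose k * L.choose (m + 1) := by
      have : 0 < (m + 2) * (k + m + 2) := by positivity
      refine Nat.eq_of_mul_eq_mul_right this ?_
      calc _ = (k + m + 2) * (k + m + 1).choose k * (L.choose (m + 2) * (m + 2)) := by ring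
        _ = _ := by rw [← b1, ← b2]; ring
    rw [show k + m + 2 + 1 = k + m + 3 by ring, a1, a3, a4, a2]
    push_cast
    zify at b
    rw [show m + 1 + 1 = m + 2 by ring]
    linear_combination -b

/-! ### Counting prefixes of small Schröder paths. -/

/-- The number of small words of length `L` with `b` steps `0`. -/
def prefixCount (L : ℕ) (b : ℤ) : ℤ :=
  ((smallWords L).filter fun w => (w.count 0 : ℤ) = b).card

/-- The number of small words of length `L` with `b` steps `0` and positive height. -/
def posPrefixCount (L : ℕ) (b : ℤ) : ℤ :=
  ((smallWords L).filter fun w => (w.count 0 : ℤ) = b ∧ 0 < height w).card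

theorem posPrefixCount_eq_zero_of_zeros_neg (L : ℕ) {b : ℤ} (hb : b < 0) :
    posPrefixCount L b = 0 := by
  simp only [posPrefixCount, Nat.cast_eq_zero, Finset.card_eq_zero, Finset.filter_eq_empty_iff]
  rintro w - ⟨h, -⟩
  omega

theorem prefixCount_eq_sum (L : ℕ) (b : ℤ) :
    prefixCount L b = ∑ h ∈ Finset.range (L + 1), smallCount L b h := by
  rw [prefixCount, Finset.card_eq_sum_card_fiberwise (f := fun w => (height w).toNat)
    (t := Finset.range (L + 1))]
  · simp only [smallCount]
    push_cast
    refine Finset.sum_congr rfl fun h _ => ?_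
    rw [Finset.filter_filter]
    congr 2
    refine Finset.filter_congr fun w hw => ?_
    have := (mem_smallWords.1 hw).2.height_nonneg
    omega
  · intro w hw
    have hw' := mem_smallWords.1 (Finset.mem_filter.1 hw).1
    have := hw'.2.height_nonneg
    have := height_le_length w
    simp
    omega

theorem prefixCount_eq_add (L : ℕ) (b : ℤ) :
    prefixCount L b = posPrefixCount L b + smallCount L b 0 := by
  rw [prefixCount, ← Finset.card_filter_add_card_filter_not (fun w => 0 < height w),
    Finset.filter_filter, Finset.filter_filter]
  simp only [posPrefixCount, smallCount]
  push_cast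
  congr 3
  refine Finset.filter_congr fun w hw => ?_
  have := (mem_smallWords.1 hw).2.height_nonneg
  omega

theorem smallCount_eq_zero_of_length_lt (L : ℕ) (b : ℤ) {h : ℤ} (hh : L < h) :
    smallCount L b h = 0 := by
  simp only [smallCount, Nat.cast_eq_zero, Finset.card_eq_zero, Finset.filter_eq_empty_iff,
    mem_smallWords]
  rintro w ⟨hw, -⟩ ⟨-, h⟩
  have := height_le_length w
  omega

theorem posPrefixCount_eq_sum (L : ℕ) (b : ℤ) :
    posPrefixCount L b = ∑ h ∈ Finset.range (L + 1), smallCount L b (h + 1) := by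
  have h1 := prefixCount_eq_add L b
  have h2 := prefixCount_eq_sum L b
  rw [Finset.sum_range_succ'] at h2
  rw [Finset.sum_range_succ, smallCount_eq_zero_of_length_lt L b (by omega : (L : ℤ) < L + 1)]
  push_cast at h2
  linarith

/-- Sum `smallCount_add` over all $h\ge 0$; the right side telescopes and only the terms at heights
$0$ and $1$ remain. -/
theorem prefixCount_add_posPrefixCount (L : ℕ) (b : ℤ) (hb : 0 ≤ b) :
    prefixCount L b + posPrefixCount L (b - 1) = wordCount L b 0 + wordCount L b 1 := by
  have key : ∀ N : ℕ, ∑ h ∈ Finset.range N, (wordCount L b h - wordCount L b (h + 2)) =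
      wordCount L b 0 + wordCount L b 1 - wordCount L b N - wordCount L b (N + 1) := by
    intro N
    induction N with
    | zero => simp
    | succ N ih =>
      rw [Finset.sum_range_succ, ih]
      push_cast
      rw [show (N : ℤ) + 1 + 1 = N + 2 by ring]
      ring
  rw [prefixCount_eq_sum, posPrefixCount_eq_sum, ← Finset.sum_add_distrib,
    Finset.sum_congr rfl fun (h : ℕ) _ => smallCount_add L b (h : ℤ) (by positivity), key,
    wordCount_eq_zero _ _ ((L + 1 : ℕ) : ℤ), wordCount_eq_zero _ _ (((L + 1 : ℕ) : ℤ) + 1)]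
  · ring
  all_goals
    right
    rw [abs_of_nonneg (by positivity)]
    push_cast
    omega

theorem height_add_count_add_length_even :
    ∀ w : List SignType, Even (height w + w.count 0 + w.length)
  | [] => by simp [height]
  | x :: w => by
    have := height_add_count_add_length_even w
    cases x <;> simp [height] <;> grind

theorem smallCount_eq_zero_of_odd (L : ℕ) (b h : ℤ) (H : Odd (L + b + h)) :
    smallCount L b h = 0 := by
  simp only [smallCount, Nat.cast_eq_zero, Finset.card_eq_zero, Finset.filter_eq_empty_iff,
    mem_smallWords]
  rintro w ⟨hw, -⟩ ⟨h1, h2⟩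
  have := height_add_count_add_length_even w
  grind

theorem wordCount_eq_zero_of_odd (L : ℕ) (b h : ℤ) (H : Odd (L + b + h)) :
    wordCount L b h = 0 := by
  induction L generalizing b h with
  | zero =>
    rw [wordCount, if_neg]
    rintro ⟨rfl, rfl⟩
    simp at H
  | succ L ih =>
    push_cast at H
    rw [wordCount, ih, ih, ih]
    · rfl
    all_goals grind

/-- The two counts differ by the words ending at height $0$. For the first length there are none, by
parity; for the second they are counted by `smallCount_closed`. -/
theorem posPrefixCount_closed_of_prefixCount (b c : ℕ) :
    posPrefixCount (b + 2 * c + 1) b = prefixCount (b + 2 * c + 1) b ∧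
    (prefixCount (b + 2 * c + 2) b = ((b + c).choose b * (b + 2 * c + 2).choose (c + 1) : ℤ) →
      posPrefixCount (b + 2 * c + 2) b =
        ((b + c + 1).choose b * (b + 2 * c + 2).choose c : ℤ)) := by
  have h1 := prefixCount_eq_add (b + 2 * c + 1) b
  have h2 := prefixCount_eq_add (b + 2 * c + 2) b
  rw [smallCount_eq_zero_of_odd _ _ _ ⟨b + c, by push_cast; ring⟩] at h1
  rw [smallCount_closed] at h2
  constructor
  · linarith
  · intro h
    linarith

/-- By parity only one of the two terms in `prefixCount_add_posPrefixCount` is nonzero. That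
identity relates $b+1$ to $b$ at the same length, so the two parity classes are exchanged at each
step of the induction and have to be proved together. -/
theorem prefixCount_closed (b c : ℕ) :
    prefixCount (b + 2 * c + 1) b = ((b + c).choose b * (b + 2 * c + 1).choose c : ℤ) ∧
    prefixCount (b + 2 * c + 2) b =
      ((b + c).choose b * (b + 2 * c + 2).choose (c + 1) : ℤ) := by
  have w0 (b c : ℕ) : wordCount (b + 2 * c + 2) b 0 =
      ((b + c + 1).choose b * (b + 2 * c + 2).choose (c + 1) : ℤ) := by
    have := wordCount_eq (c + 1) (c + 1) b
    rwa [sub_self, show c + 1 + (c + 1) + b = b + 2 * c + 2 by ring,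
      show c + 1 + b = b + c + 1 by ring] at this
  have w1 (b c : ℕ) : wordCount (b + 2 * c + 1) b 1 =
      ((b + c + 1).choose b * (b + 2 * c + 1).choose c : ℤ) := by
    have := wordCount_eq (c + 1) c b
    rwa [show ((c + 1 : ℕ) : ℤ) - c = 1 by push_cast; ring,
      show c + 1 + c + b = b + 2 * c + 1 by ring, show c + 1 + b = b + c + 1 by ring] at this
  have w0' (b c : ℕ) : wordCount (b + 2 * c + 1) b 0 = 0 :=
    wordCount_eq_zero_of_odd _ _ _ ⟨b + c, by push_cast; ring⟩
  have w1' (b c : ℕ) : wordCount (b + 2 * c + 2) b 1 = 0 :=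
    wordCount_eq_zero_of_odd _ _ _ ⟨b + c + 1, by push_cast; ring⟩
  induction b generalizing c with
  | zero =>
    have key (L : ℕ) := prefixCount_add_posPrefixCount L (0 : ℕ) le_rfl
    simp only [posPrefixCount_eq_zero_of_zeros_neg _ (by norm_num : ((0 : ℕ) : ℤ) - 1 < 0),
      add_zero] at key
    exact ⟨by rw [key, w0', w1]; simp, by rw [key, w0, w1']; simp⟩
  | succ b ih =>
    have key (L : ℕ) := prefixCount_add_posPrefixCount L (b + 1 : ℕ) (by positivity)
    rw [show ((b + 1 : ℕ) : ℤ) - 1 = b by push_cast; ring] at key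
    have p1 := (posPrefixCount_closed_of_prefixCount b (c + 1)).1
    have p2 := (posPrefixCount_closed_of_prefixCount b c).2 (ih c).2
    rw [(ih (c + 1)).1] at p1
    have k1 := key (b + 1 + 2 * c + 1)
    have k2 := key (b + 1 + 2 * c + 2)
    rw [w0', w1, show b + 1 + 2 * c + 1 = b + 2 * c + 2 by ring, p2] at k1
    rw [w0, w1', show b + 1 + 2 * c + 2 = b + 2 * (c + 1) + 1 by ring, p1] at k2
    rw [show b + 1 + 2 * c + 1 = b + 2 * c + 2 by ring,
      show b + 1 + 2 * c + 2 = b + 2 * (c + 1) + 1 by ring, show b + 1 + c = b + c + 1 by ring]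
    rw [show b + 1 + c + 1 = b + c + 1 + 1 by ring, Nat.choose_succ_succ (b + c + 1) b] at k1 k2
    rw [show b + (c + 1) = b + c + 1 by ring] at k2
    push_cast at k1 k2 ⊢
    constructor <;> linarith

theorem posPrefixCount_closed (b c : ℕ) :
    posPrefixCount (b + 2 * c + 1) b = ((b + c).choose b * (b + 2 * c + 1).choose c : ℤ) ∧
    posPrefixCount (b + 2 * c + 2) b =
      ((b + c + 1).choose b * (b + 2 * c + 2).choose c : ℤ) := by
  obtain ⟨h1, h2⟩ := posPrefixCount_closed_of_prefixCount b c
  exact ⟨h1.trans (prefixCount_closed b c).1, h2 (prefixCount_closed b c).2⟩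

/-! ### Matching the path counts with the values of the polynomial. -/

theorem smallCount_eq_eval_one {n k : ℕ} (h : k < n) :
    smallCount (2 * n - k) k 0 = (sievingPoly n k).eval 1 := by
  obtain ⟨m, rfl⟩ := Nat.exists_eq_add_of_lt h
  rw [eval_one_sievingPoly, ← smallCount_closed]
  congr 1
  omega

theorem prefixCount_eq_eval_neg_one {n b : ℕ} (h : 2 * b < n) :
    prefixCount (n - b) b = (sievingPoly n (2 * b)).eval (-1) := by
  obtain ⟨m, rfl⟩ := Nat.exists_eq_add_of_lt h
  obtain ⟨c, rfl | rfl⟩ := m.even_or_odd'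
  · rw [eval_neg_one_sievingPoly_even_even, ← (prefixCount_closed b c).1]
    congr 1
    omega
  · rw [eval_neg_one_sievingPoly_even_odd, ← (prefixCount_closed b c).2]
    congr 1
    omega

theorem posPrefixCount_eq_eval_neg_one {n b : ℕ} (h : 2 * b + 1 < n) :
    posPrefixCount (n - 1 - b) b = (sievingPoly n (2 * b + 1)).eval (-1) := by
  obtain ⟨m, rfl⟩ := Nat.exists_eq_add_of_lt h
  obtain ⟨c, rfl | rfl⟩ := m.even_or_odd'
  · rw [eval_neg_one_sievingPoly_odd_even, ← (posPrefixCount_closed b c).1]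
    congr 1
    omega
  · rw [eval_neg_one_sievingPoly_odd_odd, ← (posPrefixCount_closed b c).2]
    congr 1
    omega

/-! ### K-promotion of two-row rectangles -/

@[simp] theorem mem_rect {m n i j : ℕ} : (i, j) ∈ rect m n ↔ i < m ∧ j < n := by
  rw [← YoungDiagram.mem_cells]
  simp [rect]

theorem card_rect (m n : ℕ) : (rect m n).card = m * n := by
  simp [YoungDiagram.card, rect]

theorem exists_mem_rect_iff {m n : ℕ} {p : ℕ → ℕ → Prop} :
    (∃ b ∈ (rect m n).cells, p b.1 b.2) ↔ ∃ i j, i < m ∧ j < n ∧ p i j := by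
  simp [rect, and_assoc]

theorem slide_rect_of_le {n : ℕ} (U : ℕ → ℕ → WithTop ℕ) {i c : ℕ} (h : 2 ≤ i ∨ n ≤ c) :
    slide (rect 2 n) U i c = ⊤ := by
  rw [slide, if_neg]
  simp; omega

theorem slide_rect_zero {n : ℕ} (U : ℕ → ℕ → WithTop ℕ) {c : ℕ} (hc : c < n) :
    slide (rect 2 n) U 0 c = if U 0 c = ⊤ then min (U 0 (c + 1)) (U 1 c)
      else if 0 < c ∧ U 0 (c - 1) = ⊤ ∧ U 0 c ≤ U 1 (c - 1) then ⊤ else U 0 c := by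
  rw [slide, if_pos (by simp [hc]), seMin]
  congr 1
  refine if_congr ?_ rfl rfl
  rw [exists_mem_rect_iff (p := fun i j => IsSENeighbor i j 0 c ∧ U i j = ⊤ ∧ seMin U i j = U 0 c)]
  rcases c with _ | c
  · simp [IsSENeighbor]
  · simp [IsSENeighbor, seMin]
    omega

theorem slide_rect_one {n : ℕ} (U : ℕ → ℕ → WithTop ℕ) (hU : ∀ c, U 2 c = ⊤) {c : ℕ} (hc : c < n) :
    slide (rect 2 n) U 1 c = if U 1 c = ⊤ then U 1 (c + 1)
      else if 0 < c ∧ U 1 (c - 1) = ⊤ ∨ U 0 c = ⊤ ∧ U 1 c ≤ U 0 (c + 1) then ⊤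
      else U 1 c := by
  rw [slide, if_pos (by simp [hc]), seMin, hU]
  simp only [le_top, inf_of_le_left]
  congr 1
  refine if_congr ?_ rfl rfl
  rw [exists_mem_rect_iff (p := fun i j => IsSENeighbor i j 1 c ∧ U i j = ⊤ ∧ seMin U i j = U 1 c)]
  rcases c with _ | c
  · simp [IsSENeighbor, seMin]
    omega
  · simp [IsSENeighbor, seMin]
    constructor
    · rintro ⟨i, hi, j, hj, (⟨rfl, rfl⟩ | ⟨rfl, rfl⟩), h⟩
      · left; exact h.1
      · right; simpa using h
    · rintro (h | h)
      · refine ⟨1, by norm_num, c, by omega, by simp, h, by simp [hU]⟩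
      · exact ⟨0, by norm_num, c + 1, hc, by simp, h.1, by simpa using h.2⟩

/-- The partial filling of the two-row rectangle with rows `x` and `y` after `t` moves, if the hole
that starts in the upper left box first reaches the lower row in column `i`, and leaves the upper
row in column `j`. -/
def slideState (n i j : ℕ) (x y : ℕ → ℕ) (t r c : ℕ) : WithTop ℕ :=
  if n ≤ c then ⊤
  else if r = 0 then
    if c < j ∧ c < t then (x (c + 1) : WithTop ℕ)
    else if c = j ∧ j < t then (y j : WithTop ℕ)
    else if c = t ∧ t ≤ j then ⊤
    else (x c : WithTop ℕ)
  else if r = 1 then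
    if c < i ∨ t ≤ i ∨ t ≤ c then (y c : WithTop ℕ)
    else if c + 1 = t then ⊤
    else (y (c + 1) : WithTop ℕ)
  else ⊤

section SlideState

variable {n i j t c : ℕ} (x y : ℕ → ℕ)

theorem slideState_of_le (r : ℕ) (hc : n ≤ c) : slideState n i j x y t r c = ⊤ := by
  simp [slideState, hc]

theorem slideState_of_two_le {r : ℕ} (hr : 2 ≤ r) : slideState n i j x y t r c = ⊤ := by
  have h0 : r ≠ 0 := by omega
  have h1 : r ≠ 1 := by omega
  simp [slideState, h0, h1]

theorem slideState_zero_of_lt (hn : c < n) (hj : c < j) (ht : c < t) :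
    slideState n i j x y t 0 c = x (c + 1) := by
  simp [slideState, hn, hj, ht]

theorem slideState_zero_turn (hn : j < n) (ht : j < t) :
    slideState n i j x y t 0 j = y j := by
  simp [slideState, hn, ht]

theorem slideState_zero_hole (hj : t ≤ j) :
    slideState n i j x y t 0 t = ⊤ := by
  simp [slideState, hj]

theorem slideState_zero_of_gt (hn : c < n) (h : t < c ∨ j < c) :
    slideState n i j x y t 0 c = x c := by
  rw [slideState, if_neg (by omega), if_pos rfl, if_neg (by omega), if_neg (by omega),
    if_neg (by omega)]

theorem slideState_one_rest (hn : c < n) (h : c < i ∨ t ≤ i ∨ t ≤ c) :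
    slideState n i j x y t 1 c = y c := by
  rw [slideState, if_neg (by omega), if_neg (by omega), if_pos rfl, if_pos h]

theorem slideState_one_hole (hi : i ≤ c) : slideState n i j x y (c + 1) 1 c = ⊤ := by
  simp [slideState]
  omega

theorem slideState_one_of_lt (hn : c < n) (hi : i ≤ c) (ht : c + 1 < t) :
    slideState n i j x y t 1 c = y (c + 1) := by
  rw [slideState, if_neg (by omega), if_neg (by omega), if_pos rfl, if_neg (by omega),
    if_neg (by omega)]

end SlideState

/-- While $t\le j$ the upper row has a single hole, in column $t$. It takes the label on its right
as long as that is at most the label below, and in column $j$ it takes the strictly smaller label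
below, after which the upper row is at rest. -/
theorem slide_slideState_zero {n i j : ℕ} {x y : ℕ → ℕ} (hij : i ≤ j) (hjn : j < n)
    (h3 : ∀ c < j, x (c + 1) ≤ y c) (h4 : j + 1 < n → y j < x (j + 1)) {t c : ℕ}
    (hc : c < n) :
    slide (rect 2 n) (slideState n i j x y t) 0 c = slideState n i j x y (t + 1) 0 c := by
  rw [slide_rect_zero _ hc]
  have prev (h0 : 0 < c) (hne : c ≠ t + 1 ∨ j < t) : slideState n i j x y t 0 (c - 1) ≠ ⊤ := by
    rcases lt_trichotomy (c - 1) j with h | h | h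
    · by_cases h' : c - 1 < t
      · rw [slideState_zero_of_lt x y (by omega) h h']; exact (WithTop.natCast_ne_top _)
      · rw [slideState_zero_of_gt x y (by omega) (by omega)]; exact (WithTop.natCast_ne_top _)
    · by_cases h' : c - 1 < t
      · rw [h, slideState_zero_turn x y (by omega) (by omega)]; exact (WithTop.natCast_ne_top _)
      · rw [slideState_zero_of_gt x y (by omega) (by omega)]; exact (WithTop.natCast_ne_top _)
    · rw [slideState_zero_of_gt x y (by omega) (by omega)]; exact (WithTop.natCast_ne_top _)
  by_cases hole : c = t ∧ t ≤ j
  · obtain ⟨rfl, hcj⟩ := hole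
    rw [slideState_zero_hole x y hcj, if_pos rfl, slideState_one_rest x y hc (by omega)]
    rcases hcj.eq_or_lt with rfl | hcj
    · rw [slideState_zero_turn x y hc (by omega)]
      rcases le_or_gt n (c + 1) with h | h
      · rw [slideState_of_le x y _ h]; simp
      · rw [slideState_zero_of_gt x y h (by omega), min_eq_right]
        exact Nat.cast_le (α := WithTop ℕ).2 (h4 h).le
    · rw [slideState_zero_of_lt x y hc hcj (by omega), slideState_zero_of_gt x y (by omega) (by omega),
        min_eq_left]
      exact Nat.cast_le (α := WithTop ℕ).2 (h3 c hcj)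
  · by_cases hmove : c = t + 1 ∧ c ≤ j
    · obtain ⟨rfl, hcj⟩ := hmove
      rw [slideState_zero_of_gt x y hc (by omega), slideState_zero_hole x y hcj,
        if_neg (WithTop.natCast_ne_top _), if_pos]
      refine ⟨by omega, ?_, ?_⟩
      · exact slideState_zero_hole x y (by omega)
      · rw [slideState_one_rest x y (by omega) (by omega)]
        exact Nat.cast_le (α := WithTop ℕ).2 (h3 t (by omega))
    -- The only hole that could still threaten a label here is the one in column $j$, at time $t=j$;
    -- it spares $x_{j+1}$ because $y_j<x_{j+1}$.
    · have hrem : ¬ (0 < c ∧ slideState n i j x y t 0 (c - 1) = ⊤ ∧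
          slideState n i j x y t 0 c ≤ slideState n i j x y t 1 (c - 1)) := by
        rintro ⟨h0, h1, h2⟩
        by_cases hne : c ≠ t + 1 ∨ j < t
        · exact prev h0 hne h1
        · obtain rfl : c = t + 1 := by omega
          obtain rfl : j = t := by omega
          rw [slideState_zero_of_gt x y hc (by omega),
            slideState_one_rest x y (by omega) (by omega)] at h2
          have := Nat.cast_le (α := WithTop ℕ).1 h2
          have := h4 hc
          simp only [add_tsub_cancel_right] at *
          omega
      rw [if_neg hrem]
      by_cases h1 : c < j ∧ c < t
      · rw [slideState_zero_of_lt x y hc h1.1 h1.2, if_neg (WithTop.natCast_ne_top _),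
          slideState_zero_of_lt x y hc h1.1 (by omega)]
      · by_cases h2 : c = j ∧ j < t
        · obtain ⟨rfl, h2⟩ := h2
          rw [slideState_zero_turn x y hc h2, if_neg (WithTop.natCast_ne_top _),
            slideState_zero_turn x y hc (by omega)]
        · rw [slideState_zero_of_gt x y hc (by omega), if_neg (WithTop.natCast_ne_top _),
            slideState_zero_of_gt x y hc (by omega)]

/-- The label $y_i$ is the first lower label that is minimal for the hole above it. From time $i+1$
on the lower row has a hole in column $t-1$, which can only pull from the right. If $y_i=x_{i+1}$,
this label is removed from both neighbors, so that for a while there are holes in both rows, on one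
antidiagonal. -/
theorem slide_slideState_one {n i j : ℕ} {x y : ℕ → ℕ} (hij : i ≤ j) (hjn : j < n)
    (h1 : ∀ c < i, x (c + 1) < y c) (h2 : i + 1 < n → y i ≤ x (i + 1)) {t c : ℕ}
    (ht : t < n) (hc : c < n) :
    slide (rect 2 n) (slideState n i j x y t) 1 c = slideState n i j x y (t + 1) 1 c := by
  rw [slide_rect_one _ (fun c => slideState_of_two_le x y le_rfl) hc]
  have prev (h0 : 0 < c) (hne : c ≠ t ∨ t ≤ i) : slideState n i j x y t 1 (c - 1) ≠ ⊤ := by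
    by_cases h : c - 1 < i ∨ t ≤ i ∨ t ≤ c - 1
    · rw [slideState_one_rest x y (by omega) h]; exact (WithTop.natCast_ne_top _)
    · rw [slideState_one_of_lt x y (by omega) (by omega) (by omega)]; exact (WithTop.natCast_ne_top _)
  have above (hne : c < t) : slideState n i j x y t 0 c ≠ ⊤ := by
    rcases lt_trichotomy c j with h | h | h
    · rw [slideState_zero_of_lt x y (by omega) h hne]; exact (WithTop.natCast_ne_top _)
    · subst h
      rw [slideState_zero_turn x y (by omega) (by omega)]; exact (WithTop.natCast_ne_top _)
    · rw [slideState_zero_of_gt x y (by omega) (by omega)]; exact (WithTop.natCast_ne_top _)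
  have above' (hne : t < c) : slideState n i j x y t 0 c ≠ ⊤ := by
    rw [slideState_zero_of_gt x y (by omega) (by omega)]; exact (WithTop.natCast_ne_top _)
  by_cases hole : i ≤ c ∧ c + 1 = t
  · obtain ⟨hic, rfl⟩ := hole
    rw [slideState_one_hole x y hic, if_pos rfl, slideState_one_rest x y ht (by omega),
      slideState_one_of_lt x y hc hic (by omega)]
  · by_cases hdone : i ≤ c ∧ c + 1 < t
    · rw [slideState_one_of_lt x y hc hdone.1 hdone.2, if_neg (WithTop.natCast_ne_top _), if_neg,
        slideState_one_of_lt x y hc hdone.1 (by omega)]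
      rintro (⟨h0, h⟩ | ⟨h, -⟩)
      · exact prev h0 (by omega) h
      · exact above (by omega) h
    · rw [slideState_one_rest x y hc (by omega), if_neg (WithTop.natCast_ne_top _)]
      by_cases hmove : c = t ∧ i ≤ t
      · obtain ⟨rfl, hic⟩ := hmove
        rw [slideState_one_hole x y hic, if_pos]
        rcases hic.eq_or_lt with rfl | hic
        · right
          refine ⟨slideState_zero_hole x y hij, ?_⟩
          rcases le_or_gt n (i + 1) with h | h
          · rw [slideState_of_le x y _ h]; exact le_top
          · rw [slideState_zero_of_gt x y h (by omega)]
            exact Nat.cast_le (α := WithTop ℕ).2 (h2 h)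
        · left
          obtain ⟨c, rfl⟩ : ∃ d, c = d + 1 := ⟨c - 1, by omega⟩
          exact ⟨by omega, slideState_one_hole x y (by omega)⟩
      · rw [if_neg, slideState_one_rest x y hc (by omega)]
        rintro (⟨h0, h⟩ | ⟨h, h'⟩)
        · exact prev h0 (by omega) h
        · rcases lt_trichotomy c t with h3 | h3 | h3
          · exact above h3 h
          · subst h3
            rw [slideState_zero_of_gt x y (by omega) (by omega)] at h'
            have := Nat.cast_le (α := WithTop ℕ).1 h'
            have := h1 c (by omega)
            omega
          · exact above' h3 h

theorem slide_slideState {n i j : ℕ} {x y : ℕ → ℕ} (hij : i ≤ j) (hjn : j < n)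
    (h1 : ∀ c < i, x (c + 1) < y c) (h2 : i + 1 < n → y i ≤ x (i + 1))
    (h3 : ∀ c < j, x (c + 1) ≤ y c) (h4 : j + 1 < n → y j < x (j + 1)) {t : ℕ} (ht : t < n) :
    slide (rect 2 n) (slideState n i j x y t) = slideState n i j x y (t + 1) := by
  funext r c
  rcases le_or_gt n c with hc | hc
  · rw [slide_rect_of_le _ (Or.inr hc), slideState_of_le x y r hc]
  obtain rfl | rfl | hr : r = 0 ∨ r = 1 ∨ 2 ≤ r := by omega
  · exact slide_slideState_zero hij hjn h3 h4 hc
  · exact slide_slideState_one hij hjn h1 h2 ht hc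
  · rw [slide_rect_of_le _ (Or.inl hr), slideState_of_two_le x y hr]

theorem slide_slideState_last {n i j : ℕ} {x y : ℕ → ℕ} (hij : i ≤ j) (hjn : j < n)
    (h3 : ∀ c < j, x (c + 1) ≤ y c) (h4 : j + 1 < n → y j < x (j + 1)) :
    slide (rect 2 n) (slideState n i j x y n) = slideState n i j x y n := by
  funext r c
  rcases le_or_gt n c with hc | hc
  · rw [slide_rect_of_le _ (Or.inr hc), slideState_of_le x y r hc]
  obtain rfl | rfl | hr : r = 0 ∨ r = 1 ∨ 2 ≤ r := by omega
  · rw [slide_slideState_zero hij hjn h3 h4 hc]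
    rcases lt_trichotomy c j with h | rfl | h
    · rw [slideState_zero_of_lt x y hc h hc, slideState_zero_of_lt x y hc h (by omega)]
    · rw [slideState_zero_turn x y hc hc, slideState_zero_turn x y hc (by omega)]
    · rw [slideState_zero_of_gt x y hc (by omega), slideState_zero_of_gt x y hc (by omega)]
  · rw [slide_rect_one _ (fun c => slideState_of_two_le x y le_rfl) hc]
    have above : slideState n i j x y n 0 c ≠ ⊤ := by
      rcases lt_trichotomy c j with h | rfl | h
      · rw [slideState_zero_of_lt x y hc h hc]; exact (WithTop.natCast_ne_top _)
      · rw [slideState_zero_turn x y hc hc]; exact (WithTop.natCast_ne_top _)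
      · rw [slideState_zero_of_gt x y hc (by omega)]; exact (WithTop.natCast_ne_top _)
    by_cases hole : c + 1 = n
    · rw [slideState_of_le x y 1 hole.ge]
      subst hole
      rw [slideState_one_hole x y (by omega), if_pos rfl]
    · have hcur : slideState n i j x y n 1 c ≠ ⊤ := by
        by_cases h : c < i
        · rw [slideState_one_rest x y hc (by omega)]; exact (WithTop.natCast_ne_top _)
        · rw [slideState_one_of_lt x y hc (by omega) (by omega)]; exact (WithTop.natCast_ne_top _)
      rw [if_neg hcur, if_neg]
      rintro (⟨h0, h⟩ | ⟨h, -⟩)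
      · revert h
        by_cases h : c - 1 < i
        · rw [slideState_one_rest x y (by omega) (by omega)]; exact (WithTop.natCast_ne_top _)
        · rw [slideState_one_of_lt x y (by omega) (by omega) (by omega)]; exact (WithTop.natCast_ne_top _)
      · exact above h
  · rw [slide_rect_of_le _ (Or.inl hr), slideState_of_two_le x y hr]

theorem slide_iterate_slideState {n i j : ℕ} {x y : ℕ → ℕ} (hij : i ≤ j) (hjn : j < n)
    (h1 : ∀ c < i, x (c + 1) < y c) (h2 : i + 1 < n → y i ≤ x (i + 1))
    (h3 : ∀ c < j, x (c + 1) ≤ y c) (h4 : j + 1 < n → y j < x (j + 1)) :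
    (slide (rect 2 n))^[(rect 2 n).card] (slideState n i j x y 0) = slideState n i j x y n := by
  have key : ∀ t ≤ n, (slide (rect 2 n))^[t] (slideState n i j x y 0) = slideState n i j x y t := by
    intro t ht
    induction t with
    | zero => rfl
    | succ t ih =>
      rw [Function.iterate_succ_apply', ih (by omega), slide_slideState hij hjn h1 h2 h3 h4 (by omega)]
  -- Of the $2n$ prescribed moves the first $n$ bring the hole to the lower right corner and the
  -- other $n$ change nothing.
  rw [card_rect, two_mul, Function.iterate_add_apply, key n le_rfl,
    Function.iterate_fixed (slide_slideState_last hij hjn h3 h4)]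

/-! ### Two-row tableaux and the closed form of one K-promotion. -/

/-- `T` restricts to an increasing tableau of shape `2 × n` with largest entry `M`. -/
structure IsTwoRow (n M : ℕ) (T : ℕ → ℕ → ℕ) : Prop where
  pos : 1 ≤ n
  row : ∀ r < 2, ∀ c, c + 1 < n → T r c < T r (c + 1)
  col : ∀ c < n, T 0 c < T 1 c
  one_le : 1 ≤ T 0 0
  last : T 1 (n - 1) = M
  surj : ∀ v, 1 ≤ v → v ≤ M → ∃ c < n, T 0 c = v ∨ T 1 c = v

theorem lt_of_step_lt {n : ℕ} {x : ℕ → ℕ} (h : ∀ c, c + 1 < n → x c < x (c + 1)) {c d : ℕ}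
    (hcd : c < d) (hd : d < n) : x c < x d := by
  induction d with
  | zero => omega
  | succ d ih =>
    rcases Nat.lt_succ_iff_lt_or_eq.1 hcd with h' | rfl
    · exact (ih h' (by omega)).trans (h d hd)
    · exact h c hd

namespace IsTwoRow

variable {n M : ℕ} {T : ℕ → ℕ → ℕ}

theorem row_lt (h : IsTwoRow n M T) {r c d : ℕ} (hr : r < 2) (hcd : c < d) (hd : d < n) :
    T r c < T r d :=
  lt_of_step_lt (h.row r hr) hcd hd

theorem row_le (h : IsTwoRow n M T) {r c d : ℕ} (hr : r < 2) (hcd : c ≤ d) (hd : d < n) :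
    T r c ≤ T r d := by
  rcases hcd.eq_or_lt with rfl | hcd
  · exact le_rfl
  · exact (h.row_lt hr hcd hd).le

theorem row_lt_iff (h : IsTwoRow n M T) {r c d : ℕ} (hr : r < 2) (hc : c < n) (hd : d < n) :
    T r c < T r d ↔ c < d := by
  refine ⟨fun H => ?_, fun H => h.row_lt hr H hd⟩
  by_contra! H'
  exact absurd (h.row_le hr H' hc) (by omega)

theorem one_le_entry (h : IsTwoRow n M T) {r c : ℕ} (hr : r < 2) (hc : c < n) : 1 ≤ T r c := by
  have h0 : 1 ≤ T 0 c := h.one_le.trans (h.row_le (by norm_num) (Nat.zero_le c) hc)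
  obtain rfl | rfl : r = 0 ∨ r = 1 := by omega
  · exact h0
  · exact h0.trans (h.col c hc).le

theorem entry_le (h : IsTwoRow n M T) {r c : ℕ} (hr : r < 2) (hc : c < n) : T r c ≤ M := by
  have hp := h.pos
  have h0 : T 1 c ≤ M := (h.row_le (by norm_num) (by omega) (by omega)).trans h.last.le
  obtain rfl | rfl : r = 0 ∨ r = 1 := by omega
  · exact (h.col c hc).le.trans h0
  · exact h0

theorem zero_lt_max (h : IsTwoRow n M T) : 0 < M :=
  (h.one_le_entry (by norm_num) h.pos).trans (h.entry_le (r := 0) (by norm_num) h.pos)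

theorem maxEntry_eq (h : IsTwoRow n M T) : maxEntry (rect 2 n) T = M := by
  have hp := h.pos
  apply le_antisymm
  · refine Finset.sup_le fun b hb => ?_
    obtain ⟨r, c⟩ := b
    have := mem_rect.1 ((YoungDiagram.mem_cells _).1 hb)
    exact h.entry_le this.1 this.2
  · rw [← h.last]
    exact Finset.le_sup (f := fun c => T c.1 c.2) (b := (1, n - 1))
      ((YoungDiagram.mem_cells _).2 (mem_rect.2 ⟨by norm_num, by omega⟩))

theorem first (h : IsTwoRow n M T) : T 0 0 = 1 := by
  obtain ⟨c, hc, H⟩ := h.surj 1 le_rfl h.zero_lt_max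
  have h1 := h.one_le
  have h2 := h.row_le (r := 0) (by norm_num) (Nat.zero_le c) hc
  have h3 := h.col c hc
  omega

theorem ne_one (h : IsTwoRow n M T) {r c : ℕ} (hr : r < 2) (hc : c < n) (H : 0 < r ∨ 0 < c) :
    T r c ≠ 1 := by
  have h1 := h.first
  obtain rfl | rfl : r = 0 ∨ r = 1 := by omega
  · have := h.row_lt (r := 0) (by norm_num) (by omega : 0 < c) hc
    omega
  · have := h.row_le (r := 0) (by norm_num) (Nat.zero_le c) hc
    have := h.col c hc
    omega

theorem deleteOne_eq (h : IsTwoRow n M T) (i j : ℕ) :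
    deleteOne (rect 2 n) T = slideState n i j (T 0) (T 1) 0 := by
  funext r c
  rcases le_or_gt n c with hc | hc
  · rw [slideState_of_le _ _ _ hc, deleteOne, if_neg]
    simp; omega
  obtain rfl | rfl | hr : r = 0 ∨ r = 1 ∨ 2 ≤ r := by omega
  · rcases Nat.eq_zero_or_pos c with rfl | h0
    · rw [slideState_zero_hole _ _ (Nat.zero_le j), deleteOne, if_neg]
      simp [h.first]
    · rw [slideState_zero_of_gt _ _ hc (by omega), deleteOne, if_pos]
      exact ⟨mem_rect.2 ⟨by norm_num, hc⟩, h.ne_one (by norm_num) hc (Or.inr h0)⟩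
  · rw [slideState_one_rest _ _ hc (by omega), deleteOne, if_pos]
    exact ⟨mem_rect.2 ⟨by norm_num, hc⟩, h.ne_one (by norm_num) hc (Or.inl (by norm_num))⟩
  · rw [slideState_of_two_le _ _ hr, deleteOne, if_neg]
    simp; omega

end IsTwoRow

/-- `i` is the first column in which the hole can enter the lower row under K-promotion, and `j` is
the column in which the hole leaves the upper row. -/
structure IsSlidePath (n : ℕ) (T : ℕ → ℕ → ℕ) (i j : ℕ) : Prop where
  le : i ≤ j
  lt : j < n
  right : ∀ c < i, T 0 (c + 1) < T 1 c
  down : i + 1 < n → T 1 i ≤ T 0 (i + 1)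
  right_le : ∀ c < j, T 0 (c + 1) ≤ T 1 c
  leave : j + 1 < n → T 1 j < T 0 (j + 1)

theorem exists_isSlidePath {n : ℕ} (hn : 1 ≤ n) (T : ℕ → ℕ → ℕ) : ∃ i j, IsSlidePath n T i j := by
  classical
  have hi : ∃ i, n ≤ i + 1 ∨ T 1 i ≤ T 0 (i + 1) := ⟨n, Or.inl (by omega)⟩
  have hj : ∃ j, n ≤ j + 1 ∨ T 1 j < T 0 (j + 1) := ⟨n - 1, Or.inl (by omega)⟩
  refine ⟨Nat.find hi, Nat.find hj, ?_, ?_, ?_, ?_, ?_, ?_⟩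
  · refine Nat.find_min' hi ?_
    rcases Nat.find_spec hj with h | h
    · exact Or.inl h
    · exact Or.inr h.le
  · have := Nat.find_min' hj (m := n - 1) (Or.inl (by omega))
    omega
  · intro c hc
    have := Nat.find_min hi hc
    omega
  · intro h
    have := Nat.find_spec hi
    omega
  · intro c hc
    have := Nat.find_min hj hc
    omega
  · intro h
    have := Nat.find_spec hj
    omega

namespace IsTwoRow

variable {n M : ℕ} {T : ℕ → ℕ → ℕ} {i j : ℕ}

theorem kPromotion_zero (h : IsTwoRow n M T) (p : IsSlidePath n T i j) {c : ℕ} (hc : c < n) :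
    kPromotion (rect 2 n) T 0 c =
      (if c < j then T 0 (c + 1) else if c = j then T 1 j else T 0 c) - 1 := by
  rw [kPromotion, if_pos (mem_rect.2 ⟨by norm_num, hc⟩), h.deleteOne_eq i j,
    slide_iterate_slideState p.le p.lt p.right p.down p.right_le p.leave]
  rcases lt_trichotomy c j with H | rfl | H
  · rw [slideState_zero_of_lt _ _ hc H hc, if_pos H]; rfl
  · rw [slideState_zero_turn _ _ hc hc, if_neg (lt_irrefl _), if_pos rfl]; rfl
  · rw [slideState_zero_of_gt _ _ hc (Or.inr H), if_neg (by omega), if_neg (by omega)]; rfl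

theorem kPromotion_one (h : IsTwoRow n M T) (p : IsSlidePath n T i j) {c : ℕ} (hc : c < n) :
    kPromotion (rect 2 n) T 1 c =
      (if c < i then T 1 c else if c + 1 < n then T 1 (c + 1) else M + 1) - 1 := by
  have hp := p.le
  have hp' := p.lt
  rw [kPromotion, if_pos (mem_rect.2 ⟨by norm_num, hc⟩), h.deleteOne_eq i j,
    slide_iterate_slideState p.le p.lt p.right p.down p.right_le p.leave, h.maxEntry_eq]
  by_cases h1 : c < i
  · rw [slideState_one_rest _ _ hc (Or.inl h1), if_pos h1]; rfl
  · rw [if_neg h1]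
    by_cases h2 : c + 1 < n
    · rw [slideState_one_of_lt _ _ hc (by omega) h2, if_pos h2]; rfl
    · obtain rfl : n = c + 1 := by omega
      rw [slideState_one_hole _ _ (by omega), if_neg h2]; rfl

/-- Needed so that the closed form can be applied again to the result: promotion is defined on
arbitrary fillings, and its iterates are not a priori increasing tableaux. -/
theorem kPromotion (h : IsTwoRow n M T) : IsTwoRow n M (kPromotion (rect 2 n) T) := by
  obtain ⟨i, j, p⟩ := exists_isSlidePath h.pos T
  have hp := h.pos
  have hij := p.le
  have hjn := p.lt
  have r0 {c d : ℕ} := h.row_lt (r := 0) (c := c) (d := d) (by norm_num)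
  have r1 {c d : ℕ} := h.row_lt (r := 1) (c := c) (d := d) (by norm_num)
  have ne0 {c : ℕ} := h.one_le_entry (r := 0) (c := c) (by norm_num)
  have ne1 {c : ℕ} := h.one_le_entry (r := 1) (c := c) (by norm_num)
  have l0 {c : ℕ} := h.entry_le (r := 0) (c := c) (by norm_num)
  have l1 {c : ℕ} := h.entry_le (r := 1) (c := c) (by norm_num)
  have x2 {c : ℕ} (hc : c + 1 < n) : 2 ≤ T 0 (c + 1) := by
    have := h.ne_one (r := 0) (by norm_num) hc (by omega)
    have := ne0 hc
    omega
  have y2 {c : ℕ} (hc : c < n) : 2 ≤ T 1 c := by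
    have := h.ne_one (r := 1) (by norm_num) hc (by omega)
    have := ne1 hc
    omega
  have hM := h.zero_lt_max
  have big0 {c : ℕ} (hc : c < n) :
      2 ≤ if c < j then T 0 (c + 1) else if c = j then T 1 j else T 0 c := by
    split_ifs with a b
    · exact x2 (by omega)
    · exact y2 hjn
    · obtain ⟨c, rfl⟩ : ∃ d, c = d + 1 := ⟨c - 1, by omega⟩
      exact x2 hc
  have big1 {c : ℕ} (hc : c < n) :
      2 ≤ if c < i then T 1 c else if c + 1 < n then T 1 (c + 1) else M + 1 := by
    split_ifs with a b
    · exact y2 hc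
    · exact y2 b
    · omega
  refine ⟨hp, ?_, ?_, ?_, ?_, ?_⟩
  · intro r hr c hc
    obtain rfl | rfl : r = 0 ∨ r = 1 := by omega
    · rw [h.kPromotion_zero p (by omega), h.kPromotion_zero p hc]
      refine Nat.sub_lt_sub_right (by have := big0 (c := c) (by omega); omega) ?_
      rcases lt_trichotomy c j with H | rfl | H
      · rw [if_pos H]
        rcases Nat.lt_or_eq_of_le H with H' | H'
        · rw [if_pos H']
          exact r0 (by omega) (by omega)
        · rw [if_neg (by omega), if_pos H', show j = c + 1 from H'.symm]
          exact h.col _ hc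
      · rw [if_neg (lt_irrefl _), if_pos rfl, if_neg (by omega), if_neg (by omega)]
        exact p.leave hc
      · rw [if_neg (by omega), if_neg (by omega), if_neg (by omega), if_neg (by omega)]
        exact r0 (by omega) hc
    · rw [h.kPromotion_one p (by omega), h.kPromotion_one p hc]
      refine Nat.sub_lt_sub_right (by have := big1 (c := c) (by omega); omega) ?_
      have := l1 hc
      split_ifs
      · exact r1 (by omega) (by omega)
      · exact r1 (by omega) (by omega)
      · have := l1 (c := c) (by omega); omega
      · omega
      · exact r1 (by omega) (by omega)
      · omega
  · intro c hc
    rw [h.kPromotion_zero p hc, h.kPromotion_one p hc]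
    refine Nat.sub_lt_sub_right (by have := big0 (c := c) (by omega); omega) ?_
    have := l0 hc
    have := l1 hc
    rcases lt_trichotomy c j with H | rfl | H
    · rw [if_pos H]
      split_ifs with a b
      · exact p.right c a
      · exact (p.right_le c H).trans_lt (r1 (by omega) b)
      · omega
    · rw [if_neg (lt_irrefl _), if_pos rfl]
      split_ifs with a b
      · omega
      · exact r1 (by omega) b
      · omega
    · rw [if_neg (by omega), if_neg (by omega)]
      split_ifs with a b
      · omega
      · exact (h.col c hc).trans (r1 (by omega) b)
      · omega
  · rw [h.kPromotion_zero p hp]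
    have := big0 (c := 0) hp
    omega
  · rw [h.kPromotion_one p (by omega), if_neg (by omega), if_neg (by omega)]
    rfl
  · intro v hv1 hvM
    rcases hvM.eq_or_lt with rfl | hvM
    · refine ⟨n - 1, by omega, Or.inr ?_⟩
      rw [h.kPromotion_one p (by omega), if_neg (by omega), if_neg (by omega)]
      rfl
    · have top {c : ℕ} (hc : c + 1 < n) (H : T 0 (c + 1) = v + 1) :
          ∃ d < n, KTableau.kPromotion (rect 2 n) T 0 d = v ∨
            KTableau.kPromotion (rect 2 n) T 1 d = v := by
        by_cases a : c < j
        · refine ⟨c, by omega, Or.inl ?_⟩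
          rw [h.kPromotion_zero p (by omega), if_pos a, H]; rfl
        · refine ⟨c + 1, by omega, Or.inl ?_⟩
          rw [h.kPromotion_zero p (by omega), if_neg (by omega), if_neg (by omega), H]; rfl
      obtain ⟨c, hc, H | H⟩ := h.surj (v + 1) (by omega) hvM
      · rcases c with _ | c
        · have := h.first
          omega
        · exact top hc H
      · rcases lt_trichotomy c i with a | rfl | a
        · refine ⟨c, hc, Or.inr ?_⟩
          rw [h.kPromotion_one p hc, if_pos a, H]; rfl
        -- The label $y_i$ leaves the lower row. If $i=j$ it moves up into column $j$; if $i<j$ it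
        -- equals $x_{i+1}$, so it survives in the upper row.
        · rcases hij.eq_or_lt with rfl | hij
          · refine ⟨c, hc, Or.inl ?_⟩
            rw [h.kPromotion_zero p hc, if_neg (lt_irrefl _), if_pos rfl, H]; rfl
          · have e := p.down (by omega)
            have e' := p.right_le c hij
            exact top (c := c) (by omega) (by omega)
        · obtain ⟨c, rfl⟩ : ∃ d, c = d + 1 := ⟨c - 1, by omega⟩
          refine ⟨c, by omega, Or.inr ?_⟩
          rw [h.kPromotion_one p (by omega), if_neg (by omega), if_pos hc, H]; rfl

theorem iterate_kPromotion (h : IsTwoRow n M T) (s : ℕ) :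
    IsTwoRow n M ((KTableau.kPromotion (rect 2 n))^[s] T) := by
  induction s with
  | zero => exact h
  | succ s ih => rw [Function.iterate_succ_apply']; exact ih.kPromotion

end IsTwoRow

/-! ### Counting functions -/

/-- The number of entries `≤ v` among `x 0, …, x (n - 1)`. -/
def rowCount (n : ℕ) (x : ℕ → ℕ) (v : ℕ) : ℕ :=
  ((Finset.range n).filter fun c => x c ≤ v).card

theorem rowCount_le (n : ℕ) (x : ℕ → ℕ) (v : ℕ) : rowCount n x v ≤ n :=
  (Finset.card_filter_le _ _).trans (Finset.card_range n).le

theorem rowCount_eq_of_iff {n e v : ℕ} {x : ℕ → ℕ} (he : e ≤ n)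
    (h : ∀ c < n, x c ≤ v ↔ c < e) : rowCount n x v = e := by
  rw [rowCount, Finset.filter_congr (fun c hc => h c (Finset.mem_range.1 hc)),
    show (Finset.range n).filter (· < e) = Finset.range e by ext; simp; omega, Finset.card_range]

theorem le_iff_lt_rowCount {n v : ℕ} {x : ℕ → ℕ} (h : ∀ c, c + 1 < n → x c < x (c + 1))
    {c : ℕ} (hc : c < n) : x c ≤ v ↔ c < rowCount n x v := by
  classical
  have hex : ∃ e, n ≤ e ∨ v < x e := ⟨n, Or.inl le_rfl⟩
  have key : ∀ c < n, x c ≤ v ↔ c < Nat.find hex := by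
    intro c hc
    constructor
    · intro H
      by_contra! H'
      rcases Nat.find_spec hex with h' | h'
      · omega
      · rcases H'.eq_or_lt with h'' | h''
        · rw [h''] at h'; omega
        · have := lt_of_step_lt h h'' hc
          omega
    · intro H
      have := Nat.find_min hex H
      omega
  rw [rowCount_eq_of_iff (Nat.find_min' hex (Or.inl le_rfl)) key, key c hc]

/-! ### Running minima -/

/-- The minimum of `f 0, …, f v`. -/
def runMin (f : ℕ → ℤ) : ℕ → ℤ
  | 0 => f 0
  | v + 1 => min (runMin f v) (f (v + 1))

theorem le_runMin_iff {f : ℕ → ℤ} {v : ℕ} {z : ℤ} : z ≤ runMin f v ↔ ∀ u ≤ v, z ≤ f u := by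
  induction v with
  | zero => simp [runMin]
  | succ v ih =>
    rw [runMin, le_min_iff, ih]
    constructor
    · rintro ⟨h1, h2⟩ u hu
      rcases hu.eq_or_lt with rfl | hu
      · exact h2
      · exact h1 u (by omega)
    · exact fun h => ⟨fun u hu => h u (by omega), h _ le_rfl⟩

theorem runMin_le {f : ℕ → ℤ} {u v : ℕ} (h : u ≤ v) : runMin f v ≤ f u :=
  le_runMin_iff.1 le_rfl u h

theorem runMin_succ' (f : ℕ → ℤ) (v : ℕ) :
    runMin f (v + 1) = min (f 0) (runMin (fun u => f (u + 1)) v) := by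
  induction v with
  | zero => rfl
  | succ v ih => rw [runMin, ih, runMin, min_assoc]

theorem runMin_le_iff {f : ℕ → ℤ} {v : ℕ} {z : ℤ} : runMin f v ≤ z ↔ ∃ u ≤ v, f u ≤ z := by
  have := le_runMin_iff (f := f) (v := v) (z := z + 1)
  constructor
  · intro h
    by_contra! H
    have := this.2 fun u hu => H u hu
    omega
  · rintro ⟨u, hu, h⟩
    exact (runMin_le hu).trans h

/-! ### The row counts of iterated K-promotion -/

/-- A pair of counting functions `a`, `b` such that each step up to `M` raises one of them, or
both, by one. -/
def IsStepPair (M : ℕ) (a b : ℕ → ℤ) : Prop :=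
  ∀ u < M, (a (u + 1) = a u + 1 ∧ b (u + 1) = b u) ∨ (a (u + 1) = a u ∧ b (u + 1) = b u + 1) ∨
    (a (u + 1) = a u + 1 ∧ b (u + 1) = b u + 1)

/-- The lowest value of `a - b` on `[s, s + v]`. -/
def minHeight (a b : ℕ → ℤ) (s v : ℕ) : ℤ :=
  runMin (fun u => a (s + u) - b (s + u)) v

/-- The lowest value on `[s, s + v]` of `a - b` between the moments at which a step raises `b`
and `a`. -/
def minMidHeight (a b : ℕ → ℤ) (s v : ℕ) : ℤ :=
  runMin (fun u => if u = 0 then a s - b s else a (s + u - 1) - b (s + u)) v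

/-- The counting function of the upper row after `s` promotions. -/
def topCount (a b : ℕ → ℤ) (s v : ℕ) : ℤ := a (s + v) - b s - minHeight a b s v

/-- The counting function of the lower row after `s` promotions. -/
def botCount (a b : ℕ → ℤ) (s v : ℕ) : ℤ := b (s + v) - a s + minMidHeight a b s v

section StepPair

variable {M : ℕ} {a b : ℕ → ℤ} {s v : ℕ}

theorem minHeight_succ (a b : ℕ → ℤ) (s v : ℕ) :
    minHeight a b s (v + 1) = min (a s - b s) (minHeight a b (s + 1) v) := by
  rw [minHeight, runMin_succ']
  congr 2
  funext u
  rw [show s + (u + 1) = s + 1 + u by ring]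

theorem minMidHeight_le_start (a b : ℕ → ℤ) (s v : ℕ) : minMidHeight a b s v ≤ a s - b s :=
  runMin_le (u := 0) (Nat.zero_le v)

theorem minMidHeight_le {u : ℕ} (hu : u < v) : minMidHeight a b s v ≤ a (s + u) - b (s + u + 1) :=
  runMin_le (u := u + 1) hu

theorem minHeight_le {u : ℕ} (hu : u ≤ v) : minHeight a b s v ≤ a (s + u) - b (s + u) :=
  runMin_le hu

theorem le_minHeight_iff {z : ℤ} :
    z ≤ minHeight a b s v ↔ ∀ u ≤ v, z ≤ a (s + u) - b (s + u) :=
  le_runMin_iff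

theorem le_minMidHeight_iff {z : ℤ} :
    z ≤ minMidHeight a b s v ↔ z ≤ a s - b s ∧ ∀ u < v, z ≤ a (s + u) - b (s + u + 1) := by
  rw [minMidHeight, le_runMin_iff]
  constructor
  · exact fun h => ⟨h 0 (Nat.zero_le v), fun u hu => h (u + 1) hu⟩
  · rintro ⟨h1, h2⟩ (_ | u) hu
    · exact h1
    · exact h2 u hu

/-- In terms of the path $a-b$, the condition says that step $s+1$ goes up and that the path is back
at its height at $s$ by time $s+1+v$. This is the dichotomy of `rowCount_zero_kPromotion`, once
`leave_le_iff` has restated it through row counts. -/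
theorem topCount_succ (h : IsStepPair M a b) (hv : s + 1 + v ≤ M) :
    (∃ u, 1 ≤ u ∧ u ≤ v + 1 ∧ topCount a b s u = botCount a b s u) ∧
        topCount a b (s + 1) v = topCount a b s (v + 1) ∨
      (¬ ∃ u, 1 ≤ u ∧ u ≤ v + 1 ∧ topCount a b s u = botCount a b s u) ∧
        topCount a b (s + 1) v = topCount a b s (v + 1) - 1 := by
  have hiff : (∃ u, 1 ≤ u ∧ u ≤ v + 1 ∧ topCount a b s u = botCount a b s u) ↔
      b (s + 1) = b s ∧ minHeight a b (s + 1) v ≤ a s - b s := by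
    simp only [topCount, botCount]
    constructor
    -- Equality of the two counts says that two nonnegative quantities, the heights at $s+u$ and at
    -- $s$ minus the respective minima, have sum $0$; so both minima are attained there.
    · rintro ⟨u, h1, h2, he⟩
      have e1 := minHeight_le (a := a) (b := b) (s := s) (le_refl u)
      have e2 := minHeight_le (a := a) (b := b) (s := s) (Nat.zero_le u)
      have e3 := minMidHeight_le_start a b s u
      have e4 := minMidHeight_le (a := a) (b := b) (s := s) (u := 0) h1
      have e5 := minHeight_le (a := a) (b := b) (s := s + 1) (u := u - 1) (v := v) (by omega)
      rw [show s + 1 + (u - 1) = s + u by omega] at e5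
      simp only [add_zero] at e2 e4
      have := h s (by omega)
      constructor <;> omega
    · rintro ⟨hb, hm⟩
      have hs := h s (by omega)
      -- The witness is the first return to the height at $s$. Until then the path stays strictly
      -- above, so both minima equal the starting height.
      have hex : ∃ u, a (s + 1 + u) - b (s + 1 + u) ≤ a s - b s := by
        obtain ⟨u, -, hu⟩ := runMin_le_iff.1 hm
        exact ⟨u, hu⟩
      have hle : Nat.find hex ≤ v := by
        obtain ⟨u, hu, hu'⟩ := runMin_le_iff.1 hm
        exact (Nat.find_min' hex hu').trans hu
      obtain ⟨w, hw⟩ : ∃ w, Nat.find hex = w + 1 := by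
        refine ⟨Nat.find hex - 1, ?_⟩
        have : Nat.find hex ≠ 0 := by
          intro h0
          have := Nat.find_spec hex
          rw [h0] at this
          simp only [add_zero] at this
          omega
        omega
      have hspec := Nat.find_spec hex
      have hmin : ∀ u ≤ w, a s - b s < a (s + 1 + u) - b (s + 1 + u) := by
        intro u hu
        have := Nat.find_min hex (m := u) (by omega)
        omega
      rw [hw] at hspec hle
      have hstep := h (s + 1 + w) (by omega)
      have hlast := hmin w le_rfl
      rw [← add_assoc] at hspec
      refine ⟨w + 2, by omega, by omega, ?_⟩
      have m1 : minHeight a b s (w + 2) = a s - b s := by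
        apply le_antisymm
        · exact minHeight_le (u := 0) (Nat.zero_le _)
        · rw [le_minHeight_iff]
          rintro (_ | u) hu
          · exact le_rfl
          · rw [show s + (u + 1) = s + 1 + u by ring]
            rcases (show u ≤ w + 1 by omega).eq_or_lt with rfl | hu'
            · rw [← add_assoc]
              omega
            · exact (hmin u (by omega)).le
      have m2 : minMidHeight a b s (w + 2) = a s - b s := by
        apply le_antisymm
        · exact minMidHeight_le_start a b s _
        · rw [le_minMidHeight_iff]
          refine ⟨le_rfl, ?_⟩
          rintro (_ | u) hu
          · simp only [add_zero]
            omega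
          · have := hmin u (by omega)
            have := h (s + 1 + u) (by omega)
            rw [show s + (u + 1) = s + 1 + u by ring]
            omega
      rw [m1, m2, show s + (w + 2) = s + 1 + w + 1 by ring]
      omega
  have hs := h s (by omega)
  rw [hiff]
  simp only [topCount]
  rw [minHeight_succ, show s + 1 + v = s + (v + 1) by ring]
  have := minHeight_le (a := a) (b := b) (s := s + 1) (Nat.zero_le v)
  simp only [add_zero] at this
  omega

/-- The separate starting values at $s$ and $s+1$ do not matter: both are at least $a(s)-b(s+1)$. -/
theorem minMidHeight_succ (h : IsStepPair M a b) (hv : s + 1 + v ≤ M) :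
    minMidHeight a b s (v + 1) = min (a s - b (s + 1)) (minMidHeight a b (s + 1) v) := by
  have hs := h s (by omega)
  apply le_antisymm
  · refine le_min (minMidHeight_le (u := 0) (by omega)) (le_minMidHeight_iff.2 ⟨?_, ?_⟩)
    · have := minMidHeight_le (a := a) (b := b) (s := s) (u := 0) (v := v + 1) (by omega)
      simp only [add_zero] at this
      omega
    · intro u hu
      have := minMidHeight_le (a := a) (b := b) (s := s) (u := u + 1) (v := v + 1) (by omega)
      rwa [show s + (u + 1) = s + 1 + u by ring] at this
  · refine le_minMidHeight_iff.2 ⟨(min_le_left _ _).trans (by omega), ?_⟩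
    rintro (_ | u) hu
    · exact min_le_left _ _
    · rw [show s + (u + 1) = s + 1 + u by ring]
      exact (min_le_right _ _).trans (minMidHeight_le (by omega))

/-- The counterpart of `topCount_succ` for the lower row: step $s+1$ raises $a$, and the mid-height
comes back to its value at that step. It matches `rowCount_one_kPromotion` through `enter_le_iff`.
-/
theorem botCount_succ (h : IsStepPair M a b) (hv : s + 1 + v ≤ M) :
    (∃ u, 1 ≤ u ∧ u ≤ v ∧ topCount a b s u = botCount a b s (u + 1)) ∧
        botCount a b (s + 1) v = botCount a b s (v + 1) - 1 ∨
      (¬ ∃ u, 1 ≤ u ∧ u ≤ v ∧ topCount a b s u = botCount a b s (u + 1)) ∧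
        botCount a b (s + 1) v = botCount a b s (v + 1) := by
  have hs := h s (by omega)
  have hiff : (∃ u, 1 ≤ u ∧ u ≤ v ∧ topCount a b s u = botCount a b s (u + 1)) ↔
      a (s + 1) = a s + 1 ∧ minMidHeight a b (s + 1) v ≤ a s - b (s + 1) := by
    simp only [topCount, botCount]
    constructor
    · rintro ⟨u, h1, h2, he⟩
      have e1 := minHeight_le (a := a) (b := b) (s := s) (Nat.zero_le u)
      have e2 := minHeight_le (a := a) (b := b) (s := s) h1
      have e3 := minMidHeight_le (a := a) (b := b) (s := s) (u := 0) (v := u + 1) (by omega)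
      have e4 := minMidHeight_le (a := a) (b := b) (s := s) (u := u) (v := u + 1) (by omega)
      have e5 := minMidHeight_le (a := a) (b := b) (s := s + 1) (u := u - 1) (v := v) (by omega)
      rw [show s + 1 + (u - 1) = s + u by omega] at e5
      simp only [add_zero] at e1 e3
      rw [← add_assoc] at he
      constructor <;> omega
    · rintro ⟨ha, hm⟩
      have hbd : ∃ u, u < v ∧ a (s + 1 + u) - b (s + 1 + u + 1) ≤ a s - b (s + 1) := by
        by_contra! H
        have := le_minMidHeight_iff (a := a) (b := b) (s := s + 1) (v := v)
          (z := a s - b (s + 1) + 1)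
        have := this.2 ⟨by omega, fun u hu => H u hu⟩
        omega
      have hex : ∃ u, a (s + 1 + u) - b (s + 1 + u + 1) ≤ a s - b (s + 1) := by
        obtain ⟨u, -, hu⟩ := hbd
        exact ⟨u, hu⟩
      have hle : Nat.find hex < v := by
        obtain ⟨u, hu, hu'⟩ := hbd
        exact (Nat.find_min' hex hu').trans_lt hu
      have hspec := Nat.find_spec hex
      have hmin : ∀ u < Nat.find hex, a s - b (s + 1) < a (s + 1 + u) - b (s + 1 + u + 1) := by
        intro u hu
        have := Nat.find_min hex hu
        omega
      revert hle hspec hmin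
      generalize Nat.find hex = w
      intro hle hspec hmin
      have hheight : ∀ u ≤ w, a s - b (s + 1) < a (s + 1 + u) - b (s + 1 + u) := by
        rintro (_ | u) hu
        · simp only [add_zero]
          omega
        · have := hmin u (by omega)
          have := h (s + 1 + u) (by omega)
          rw [← add_assoc]
          omega
      have hw := hheight w le_rfl
      have hstep := h (s + 1 + w) (by omega)
      refine ⟨w + 1, by omega, by omega, ?_⟩
      have m1 : minHeight a b s (w + 1) = a s - b s := by
        apply le_antisymm
        · exact minHeight_le (u := 0) (Nat.zero_le _)
        · rw [le_minHeight_iff]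
          rintro (_ | u) hu
          · exact le_rfl
          · rw [show s + (u + 1) = s + 1 + u by ring]
            have := hheight u (by omega)
            omega
      have m2 : minMidHeight a b s (w + 1 + 1) = a s - b (s + 1) := by
        apply le_antisymm
        · exact minMidHeight_le (u := 0) (by omega)
        · rw [le_minMidHeight_iff]
          refine ⟨by omega, ?_⟩
          rintro (_ | u) hu
          · exact le_rfl
          · rw [show s + (u + 1) = s + 1 + u by ring]
            rcases (show u ≤ w by omega).eq_or_lt with rfl | hu'
            · omega
            · exact (hmin u hu').le
      rw [m1, m2, show s + (w + 1 + 1) = s + 1 + w + 1 by ring,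
        show s + (w + 1) = s + 1 + w by ring]
      omega
  have hm := minMidHeight_le_start a b (s + 1) v
  rw [hiff]
  clear hiff
  simp only [botCount]
  rw [minMidHeight_succ h hv, show s + 1 + v = s + (v + 1) by ring]
  omega

end StepPair

/-! ### Row counts of a tableau and the effect of one K-promotion on them. -/

theorem rowCount_succ_of_eq {n v : ℕ} {x : ℕ → ℕ} (h : ∀ c, c + 1 < n → x c < x (c + 1))
    {c : ℕ} (hc : c < n) (hv : x c = v + 1) : rowCount n x v = c ∧ rowCount n x (v + 1) = c + 1 := by
  have lt {d e : ℕ} (hde : d < e) (he : e < n) := lt_of_step_lt h hde he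
  constructor
  · refine rowCount_eq_of_iff hc.le fun d hd => ?_
    rcases lt_trichotomy d c with H | rfl | H
    · have := lt H hc
      omega
    · omega
    · have := lt H hd
      omega
  · refine rowCount_eq_of_iff hc fun d hd => ?_
    rcases lt_trichotomy d c with H | rfl | H
    · have := lt H hc
      omega
    · omega
    · have := lt H hd
      omega

theorem rowCount_succ_of_ne {n v : ℕ} {x : ℕ → ℕ} (hv : ∀ c < n, x c ≠ v + 1) :
    rowCount n x (v + 1) = rowCount n x v := by
  rw [rowCount, rowCount]
  congr 1
  refine Finset.filter_congr fun c hc => ?_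
  have := hv c (Finset.mem_range.1 hc)
  omega

namespace IsTwoRow

variable {n M : ℕ} {T : ℕ → ℕ → ℕ} {i j : ℕ}

theorem le_iff (h : IsTwoRow n M T) {r c v : ℕ} (hr : r < 2) (hc : c < n) :
    T r c ≤ v ↔ c < rowCount n (T r) v :=
  le_iff_lt_rowCount (h.row r hr) hc

theorem rowCount_succ_cases (h : IsTwoRow n M T) {r : ℕ} (hr : r < 2) (v : ℕ) :
    (∃ c < n, T r c = v + 1) ∧ rowCount n (T r) (v + 1) = rowCount n (T r) v + 1 ∨
      (∀ c < n, T r c ≠ v + 1) ∧ rowCount n (T r) (v + 1) = rowCount n (T r) v := by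
  by_cases H : ∃ c < n, T r c = v + 1
  · left
    refine ⟨H, ?_⟩
    obtain ⟨c, hc, hv⟩ := H
    obtain ⟨h1, h2⟩ := rowCount_succ_of_eq (h.row r hr) hc hv
    omega
  · right
    push Not at H
    exact ⟨H, rowCount_succ_of_ne H⟩

theorem isStepPair (h : IsTwoRow n M T) :
    IsStepPair M (fun v => rowCount n (T 0) v) (fun v => rowCount n (T 1) v) := by
  intro v hv
  have h0 := h.rowCount_succ_cases (r := 0) (by norm_num) v
  have h1 := h.rowCount_succ_cases (r := 1) (by norm_num) v
  obtain ⟨c, hc, H⟩ := h.surj (v + 1) (by omega) hv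
  simp only
  rcases h0 with ⟨-, h0⟩ | ⟨H0, h0⟩ <;> rcases h1 with ⟨-, h1⟩ | ⟨H1, h1⟩
  · omega
  · omega
  · omega
  · exact absurd H (not_or_intro (H0 c hc) (H1 c hc))

theorem rowCount_zero (h : IsTwoRow n M T) {r : ℕ} (hr : r < 2) : rowCount n (T r) 0 = 0 := by
  refine rowCount_eq_of_iff (Nat.zero_le n) fun c hc => ?_
  have := h.one_le_entry hr hc
  omega

theorem rowCount_max (h : IsTwoRow n M T) {r : ℕ} (hr : r < 2) : rowCount n (T r) M = n := by
  refine rowCount_eq_of_iff le_rfl fun c hc => ?_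
  have := h.entry_le hr hc
  omega

/-- Strictness of columns in terms of counts: the mid-heights are nonnegative, so a step that raises
the lower count starts at positive height. -/
theorem rowCount_one_succ_le (h : IsTwoRow n M T) (v : ℕ) :
    rowCount n (T 1) (v + 1) ≤ rowCount n (T 0) v := by
  by_contra! H
  have hn := rowCount_le n (T 1) (v + 1)
  have h1 := (h.le_iff (r := 1) (v := v + 1) (by norm_num)
    (by omega : rowCount n (T 0) v < n)).2 H
  have h2 := (h.le_iff (r := 0) (v := v) (by norm_num) (by omega : rowCount n (T 0) v < n)).1
  have h3 := h.col (rowCount n (T 0) v) (by omega)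
  have := h2 (by omega)
  omega

theorem rowCount_one_le (h : IsTwoRow n M T) (v : ℕ) :
    rowCount n (T 1) v ≤ rowCount n (T 0) v := by
  rcases v with _ | v
  · rw [h.rowCount_zero (by norm_num), h.rowCount_zero (by norm_num)]
  · refine (h.rowCount_one_succ_le v).trans ?_
    have := h.rowCount_succ_cases (r := 0) (by norm_num) v
    omega

/-- The label $y_j$ that fills the upper row is the first positive time at which the path is at
height $0$: at that time both rows have filled exactly the columns $0,\dots,j$. -/
theorem leave_le_iff (h : IsTwoRow n M T) (p : IsSlidePath n T i j) (v : ℕ) :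
    T 1 j ≤ v ↔ ∃ u, 1 ≤ u ∧ u ≤ v ∧ rowCount n (T 0) u = rowCount n (T 1) u := by
  constructor
  · intro H
    refine ⟨T 1 j, h.one_le_entry (by norm_num) p.lt, H, ?_⟩
    rw [rowCount_eq_of_iff p.lt, rowCount_eq_of_iff p.lt]
    · intro c hc
      rw [← not_lt, h.row_lt_iff (by norm_num) p.lt hc]
      omega
    · intro c hc
      rcases le_or_gt c j with H' | H'
      · have := h.col j p.lt
        have := h.row_le (r := 0) (by norm_num) H' p.lt
        omega
      · have := p.leave (by omega)
        have := h.row_le (r := 0) (c := j + 1) (by norm_num) H' hc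
        omega
  · rintro ⟨u, h1, h2, he⟩
    have h0 := (h.le_iff (r := 0) (v := u) (by norm_num) h.pos).1 (by rw [h.first]; exact h1)
    have hn := rowCount_le n (T 1) u
    obtain ⟨c, hc⟩ : ∃ c, rowCount n (T 1) u = c + 1 := ⟨rowCount n (T 1) u - 1, by omega⟩
    have hy := (h.le_iff (r := 1) (v := u) (c := c) (by norm_num) (by omega)).2 (by omega)
    have hjc : j ≤ c := by
      by_contra! H
      have := p.lt
      have := p.right_le c H
      have := (h.le_iff (r := 0) (v := u) (c := c + 1) (by norm_num) (by omega)).1 (by omega)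
      omega
    have := h.row_le (r := 1) (by norm_num) hjc (by omega)
    omega

/-- The label $y_i$ that leaves the lower row is the time of the first flat or down step starting at
height $1$, that is, of the first mid-height $0$ after the first step. -/
theorem enter_le_iff (h : IsTwoRow n M T) (p : IsSlidePath n T i j) (v : ℕ) :
    T 1 i ≤ v + 1 ↔ ∃ u, 1 ≤ u ∧ u ≤ v ∧ rowCount n (T 0) u = rowCount n (T 1) (u + 1) := by
  have hi := p.le.trans_lt p.lt
  constructor
  · intro H
    have h1 := h.one_le_entry (r := 0) (by norm_num) hi
    have h2 := h.col i hi
    refine ⟨T 1 i - 1, by omega, by omega, ?_⟩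
    rw [Nat.sub_add_cancel (by omega), rowCount_eq_of_iff hi, rowCount_eq_of_iff hi]
    · intro c hc
      rw [← not_lt, h.row_lt_iff (by norm_num) hi hc]
      omega
    · intro c hc
      rcases le_or_gt c i with H' | H'
      · have := h.row_le (r := 0) (by norm_num) H' hi
        omega
      · have := p.down (by omega)
        have := h.row_le (r := 0) (c := i + 1) (by norm_num) H' hc
        omega
  · rintro ⟨u, h1, h2, he⟩
    have h0 := (h.le_iff (r := 0) (v := u) (by norm_num) h.pos).1 (by rw [h.first]; exact h1)
    have hn := rowCount_le n (T 1) (u + 1)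
    obtain ⟨c, hc⟩ : ∃ c, rowCount n (T 1) (u + 1) = c + 1 :=
      ⟨rowCount n (T 1) (u + 1) - 1, by omega⟩
    have hy := (h.le_iff (r := 1) (v := u + 1) (c := c) (by norm_num) (by omega)).2 (by omega)
    have hjc : i ≤ c := by
      by_contra! H
      have := p.right c H
      have := (h.le_iff (r := 0) (v := u) (c := c + 1) (by norm_num) (by omega)).1 (by omega)
      omega
    have := h.row_le (r := 1) (by norm_num) hjc (by omega)
    omega

/-- Up to the shift of labels, the upper row loses its first entry and gains $y_j$; the count drops
until $y_j$ is reached. -/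
theorem rowCount_zero_kPromotion (h : IsTwoRow n M T) (p : IsSlidePath n T i j) (v : ℕ) :
    T 1 j ≤ v + 1 ∧ rowCount n (KTableau.kPromotion (rect 2 n) T 0) v = rowCount n (T 0) (v + 1) ∨
      ¬ T 1 j ≤ v + 1 ∧
        rowCount n (KTableau.kPromotion (rect 2 n) T 0) v + 1 = rowCount n (T 0) (v + 1) := by
  have hj := p.lt
  have hn := rowCount_le n (T 0) (v + 1)
  have le0 {c : ℕ} (hc : c < n) := h.le_iff (r := 0) (c := c) (v := v + 1) (by norm_num) hc
  have h0 := (le0 h.pos).1 (by rw [h.first]; omega)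
  have hcol := h.col j hj
  have hlj := le0 hj
  by_cases H : T 1 j ≤ v + 1
  · left
    refine ⟨H, rowCount_eq_of_iff hn fun c hc => ?_⟩
    rw [h.kPromotion_zero p hc, Nat.sub_le_iff_le_add]
    rcases lt_trichotomy c j with H' | rfl | H'
    · rw [if_pos H', le0 (by omega)]
      omega
    · rw [if_neg (lt_irrefl _), if_pos rfl]
      omega
    · rw [if_neg (by omega), if_neg (by omega), le0 hc]
  · right
    refine ⟨H, ?_⟩
    have hle : rowCount n (T 0) (v + 1) ≤ j + 1 := by
      by_contra! H'
      have := (le0 (c := j + 1) (by omega)).2 H'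
      have := p.leave (by omega)
      omega
    rw [rowCount_eq_of_iff (e := rowCount n (T 0) (v + 1) - 1) (by omega)]
    · omega
    intro c hc
    rw [h.kPromotion_zero p hc, Nat.sub_le_iff_le_add]
    rcases lt_trichotomy c j with H' | rfl | H'
    · rw [if_pos H', le0 (by omega)]
      omega
    · rw [if_neg (lt_irrefl _), if_pos rfl]
      omega
    · rw [if_neg (by omega), if_neg (by omega), le0 hc]
      omega

/-- Up to the shift of labels, the lower row loses $y_i$ and gains $M+1$; for $v<M$ the new label is
not yet counted. -/
theorem rowCount_one_kPromotion (h : IsTwoRow n M T) (p : IsSlidePath n T i j) {v : ℕ}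
    (hv : v < M) :
    T 1 i ≤ v + 1 ∧
        rowCount n (KTableau.kPromotion (rect 2 n) T 1) v + 1 = rowCount n (T 1) (v + 1) ∨
      ¬ T 1 i ≤ v + 1 ∧
        rowCount n (KTableau.kPromotion (rect 2 n) T 1) v = rowCount n (T 1) (v + 1) := by
  have hi := p.le.trans_lt p.lt
  have hn := rowCount_le n (T 1) (v + 1)
  have le1 {c : ℕ} (hc : c < n) := h.le_iff (r := 1) (c := c) (v := v + 1) (by norm_num) hc
  have hli := le1 hi
  by_cases H : T 1 i ≤ v + 1
  · left
    refine ⟨H, ?_⟩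
    rw [rowCount_eq_of_iff (e := rowCount n (T 1) (v + 1) - 1) (by omega)]
    · omega
    intro c hc
    rw [h.kPromotion_one p hc, Nat.sub_le_iff_le_add]
    split_ifs with a b
    · rw [le1 hc]
      omega
    · rw [le1 b]
      omega
    · omega
  · right
    refine ⟨H, rowCount_eq_of_iff hn fun c hc => ?_⟩
    rw [h.kPromotion_one p hc, Nat.sub_le_iff_le_add]
    split_ifs with a b
    · rw [le1 hc]
    · rw [le1 b]
      omega
    · omega

/-- The row counts of the iterates of K-promotion. -/
theorem rowCount_iterate_kPromotion (h : IsTwoRow n M T) (s : ℕ) :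
    ∀ v, s + v ≤ M →
      (rowCount n ((KTableau.kPromotion (rect 2 n))^[s] T 0) v : ℤ) =
        topCount (fun v => rowCount n (T 0) v) (fun v => rowCount n (T 1) v) s v ∧
      (rowCount n ((KTableau.kPromotion (rect 2 n))^[s] T 1) v : ℤ) =
        botCount (fun v => rowCount n (T 0) v) (fun v => rowCount n (T 1) v) s v := by
  induction s with
  | zero =>
    intro v _
    have z0 := h.rowCount_zero (r := 0) (by norm_num)
    have z1 := h.rowCount_zero (r := 1) (by norm_num)
    have m1 : minHeight (fun v => (rowCount n (T 0) v : ℤ)) (fun v => (rowCount n (T 1) v : ℤ)) 0 v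
        = 0 := by
      apply le_antisymm
      · refine (minHeight_le (Nat.zero_le v)).trans ?_
        simp [z0, z1]
      · rw [le_minHeight_iff]
        intro u _
        have := h.rowCount_one_le (0 + u)
        omega
    have m2 : minMidHeight (fun v => (rowCount n (T 0) v : ℤ)) (fun v => (rowCount n (T 1) v : ℤ))
        0 v = 0 := by
      apply le_antisymm
      · refine (minMidHeight_le_start _ _ _ _).trans ?_
        simp [z0, z1]
      · rw [le_minMidHeight_iff]
        refine ⟨by simp [z0, z1], fun u _ => ?_⟩
        have := h.rowCount_one_succ_le (0 + u)
        omega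
    simp [topCount, botCount, m1, m2, z0, z1]
  | succ s ih =>
    intro v hv
    have hs := h.iterate_kPromotion s
    obtain ⟨i, j, p⟩ := exists_isSlidePath h.pos ((KTableau.kPromotion (rect 2 n))^[s] T)
    rw [Function.iterate_succ_apply']
    have t0 := hs.rowCount_zero_kPromotion p v
    have t1 := hs.rowCount_one_kPromotion p (v := v) (by omega)
    rw [hs.leave_le_iff p] at t0
    rw [hs.enter_le_iff p] at t1
    have q0 := topCount_succ h.isStepPair (s := s) (v := v) hv
    have q1 := botCount_succ h.isStepPair (s := s) (v := v) hv
    have e0 := (ih (v + 1) (by omega)).1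
    have e1 := (ih (v + 1) (by omega)).2
    have c0 : (∃ u, 1 ≤ u ∧ u ≤ v + 1 ∧ rowCount n ((KTableau.kPromotion (rect 2 n))^[s] T 0) u =
        rowCount n ((KTableau.kPromotion (rect 2 n))^[s] T 1) u) ↔
        (∃ u, 1 ≤ u ∧ u ≤ v + 1 ∧
          topCount (fun v => (rowCount n (T 0) v : ℤ)) (fun v => (rowCount n (T 1) v : ℤ)) s u =
          botCount (fun v => (rowCount n (T 0) v : ℤ)) (fun v => (rowCount n (T 1) v : ℤ)) s u) := by
      refine exists_congr fun u => and_congr_right fun _ => and_congr_right fun hu => ?_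
      rw [← (ih u (by omega)).1, ← (ih u (by omega)).2, Nat.cast_inj]
    have c1 : (∃ u, 1 ≤ u ∧ u ≤ v ∧ rowCount n ((KTableau.kPromotion (rect 2 n))^[s] T 0) u =
        rowCount n ((KTableau.kPromotion (rect 2 n))^[s] T 1) (u + 1)) ↔
        (∃ u, 1 ≤ u ∧ u ≤ v ∧
          topCount (fun v => (rowCount n (T 0) v : ℤ)) (fun v => (rowCount n (T 1) v : ℤ)) s u =
          botCount (fun v => (rowCount n (T 0) v : ℤ)) (fun v => (rowCount n (T 1) v : ℤ)) s
            (u + 1)) := by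
      refine exists_congr fun u => and_congr_right fun _ => and_congr_right fun hu => ?_
      rw [← (ih u (by omega)).1, ← (ih (u + 1) (by omega)).2, Nat.cast_inj]
    rw [c0] at t0
    rw [c1] at t1
    constructor
    · rcases q0 with ⟨hP, q⟩ | ⟨hP, q⟩ <;> rcases t0 with ⟨hP', t⟩ | ⟨hP', t⟩ <;>
        first | exact absurd hP hP' | exact absurd hP' hP | (clear hP hP' c0 c1 q1 t1; omega)
    · rcases q1 with ⟨hP, q⟩ | ⟨hP, q⟩ <;> rcases t1 with ⟨hP', t⟩ | ⟨hP', t⟩ <;>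
        first | exact absurd hP hP' | exact absurd hP' hP | (clear hP hP' c0 c1 q0 t0; omega)

/-- The shape of the entries `≤ M - s` of the `s`-th K-promotion is the rotated shape of the entries
`> s`. -/
theorem rowCount_iterate_kPromotion_sub (h : IsTwoRow n M T) {s : ℕ} (hs : s ≤ M) :
    rowCount n ((KTableau.kPromotion (rect 2 n))^[s] T 0) (M - s) + rowCount n (T 1) s = n ∧
    rowCount n ((KTableau.kPromotion (rect 2 n))^[s] T 1) (M - s) + rowCount n (T 0) s = n := by
  obtain ⟨h0, h1⟩ := h.rowCount_iterate_kPromotion s (M - s) (by omega)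
  have z0 := h.rowCount_max (r := 0) (by norm_num)
  have z1 := h.rowCount_max (r := 1) (by norm_num)
  -- The path is at height $0$ at time $M$ and its heights and mid-heights are never negative, so
  -- both minima over $[s,M]$ are $0$.
  have m1 : minHeight (fun v => (rowCount n (T 0) v : ℤ)) (fun v => (rowCount n (T 1) v : ℤ)) s
      (M - s) = 0 := by
    apply le_antisymm
    · refine (minHeight_le le_rfl).trans ?_
      rw [Nat.add_sub_cancel' hs]
      simp [z0, z1]
    · rw [le_minHeight_iff]
      intro u _
      have := h.rowCount_one_le (s + u)
      omega
  have m2 : minMidHeight (fun v => (rowCount n (T 0) v : ℤ)) (fun v => (rowCount n (T 1) v : ℤ)) s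
      (M - s) = 0 := by
    apply le_antisymm
    · rcases hs.eq_or_lt with rfl | hs
      · refine (minMidHeight_le_start _ _ _ _).trans ?_
        simp [z0, z1]
      · refine (minMidHeight_le (u := M - s - 1) (by omega)).trans ?_
        rw [show s + (M - s - 1) + 1 = M by omega]
        have := rowCount_le n (T 0) (s + (M - s - 1))
        simp only [z1]
        omega
    · rw [le_minMidHeight_iff]
      have := h.rowCount_one_le s
      refine ⟨by omega, fun u _ => ?_⟩
      have := h.rowCount_one_succ_le (s + u)
      omega
  simp only [topCount, botCount, m1, m2] at h0 h1
  rw [Nat.add_sub_cancel' hs] at h0 h1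
  rw [z0] at h0
  rw [z1] at h1
  omega

end IsTwoRow

/-! ### Symmetric words -/

/-- The word of the rotated and complemented tableau. -/
def dualWord (w : List SignType) : List SignType := (w.map (-·)).reverse

theorem height_append : ∀ u w : List SignType, height (u ++ w) = height u + height w
  | [], w => by simp [height]
  | x :: u, w => by
    rw [List.cons_append, height, height, height_append u w]
    ring

theorem height_dualWord (w : List SignType) : height (dualWord w) = -height w := by
  induction w with
  | nil => rfl
  | cons x w ih =>
    rw [dualWord, List.map_cons, List.reverse_cons, height_append, ← dualWord, ih]
    simp [height]
    ring

theorem dualWord_dualWord (w : List SignType) : dualWord (dualWord w) = w := by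
  simp [dualWord]

theorem dualWord_append (u w : List SignType) : dualWord (u ++ w) = dualWord w ++ dualWord u := by
  simp [dualWord]

theorem length_dualWord (w : List SignType) : (dualWord w).length = w.length := by
  simp [dualWord]

theorem count_zero_dualWord (w : List SignType) : (dualWord w).count 0 = w.count 0 := by
  rw [dualWord, List.count_reverse]
  exact List.count_map_of_injective w (-· : SignType → SignType) neg_injective 0

theorem IsSmall.of_append : ∀ {u w : List SignType}, IsSmall (u ++ w) → IsSmall w
  | [], _, h => h
  | _ :: u, _, h => IsSmall.of_append (u := u) h.1

/-- The dual of $y$ retraces $y$ backwards, starting from the height where $y$ ended. An up step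
turns into a down step from positive height, a flat step stays at its positive height, and a down
step turns into an up step, which is never restricted. -/
theorem IsSmall.dualWord_append : ∀ {y w : List SignType}, IsSmall y → IsSmall w →
    height w = height y → IsSmall (dualWord y ++ w)
  | [], _, _, hw, _ => hw
  | x :: y, w, hy, hw, h => by
    have hn := hy.1.height_nonneg
    have e : dualWord (x :: y) ++ w = dualWord y ++ (-x :: w) := by simp [dualWord]
    rw [e]
    refine IsSmall.dualWord_append hy.1 ⟨hw, fun hx => ?_⟩ ?_
    · rw [h, height]
      have hy2 := hy.2
      cases x
      · have := hy2 (by decide)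
        simpa using this
      · exact absurd rfl hx
      · have : 0 < height y + 1 := by omega
        simpa using this
    · rw [height, h, height]
      simp

/-- The small words of length `M` with `k` steps `0` that are their own dual. -/
def symmetricWords (M k : ℕ) : Finset (List SignType) :=
  (smallWords M).filter fun w => w.count 0 = k ∧ dualWord w = w

theorem card_symmetricWords_even (L b : ℕ) :
    ((symmetricWords (2 * L) (2 * b)).card : ℤ) = prefixCount L b := by
  rw [prefixCount, Nat.cast_inj]
  symm
  refine Finset.card_bij' (fun z _ => dualWord z ++ z) (fun w _ => w.drop L) ?_ ?_ ?_ ?_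
  · intro z hz
    obtain ⟨hz, hb⟩ := Finset.mem_filter.1 hz
    obtain ⟨hl, hs⟩ := mem_smallWords.1 hz
    refine Finset.mem_filter.2 ⟨mem_smallWords.2 ⟨?_, hs.dualWord_append hs rfl⟩, ?_, ?_⟩
    · rw [List.length_append, length_dualWord]
      omega
    · rw [List.count_append, count_zero_dualWord]
      omega
    · rw [KTableau.dualWord_append, dualWord_dualWord]
  · intro w hw
    obtain ⟨hw, hk, hd⟩ := Finset.mem_filter.1 hw
    obtain ⟨hl, hs⟩ := mem_smallWords.1 hw
    have h := List.take_append_drop L w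
    refine Finset.mem_filter.2 ⟨mem_smallWords.2 ⟨by simp; omega, ?_⟩, ?_⟩
    · rw [← h] at hs
      exact hs.of_append
    · rw [← h, KTableau.dualWord_append] at hd
      have := (List.append_inj hd (by simp [length_dualWord]; omega)).1
      rw [← h, ← this, List.count_append, count_zero_dualWord] at hk
      omega
  · intro z hz
    obtain ⟨hz, hb⟩ := Finset.mem_filter.1 hz
    obtain ⟨hl, hs⟩ := mem_smallWords.1 hz
    exact List.drop_left' (by rw [length_dualWord, hl])
  · intro w hw
    obtain ⟨hw, hk, hd⟩ := Finset.mem_filter.1 hw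
    obtain ⟨hl, hs⟩ := mem_smallWords.1 hw
    have h := List.take_append_drop L w
    rw [← h, KTableau.dualWord_append] at hd
    have := (List.append_inj hd (by simp [length_dualWord]; omega)).1
    rw [this, h]

theorem eq_dualWord_append_zero_cons {L : ℕ} {w : List SignType} (hl : w.length = 2 * L + 1)
    (hd : dualWord w = w) : w = dualWord (w.drop (L + 1)) ++ 0 :: w.drop (L + 1) := by
  obtain ⟨x, hx⟩ : ∃ x, w.drop L = x :: w.drop (L + 1) :=
    ⟨w[L], List.drop_eq_getElem_cons (by omega)⟩
  have h := List.take_append_drop L w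
  rw [hx] at h
  have hd' := hd
  rw [← h, KTableau.dualWord_append] at hd'
  have e : dualWord (x :: w.drop (L + 1)) = dualWord (w.drop (L + 1)) ++ [-x] := by
    simp [dualWord]
  rw [e, List.append_assoc] at hd'
  obtain ⟨h1, h2⟩ := List.append_inj hd' (by simp [length_dualWord]; omega)
  -- Self-duality forces the middle letter to equal its own negative.
  have hx0 : x = 0 := by
    have := (List.cons.inj h2).1
    revert this
    cases x <;> decide
  rw [h1, ← hx0, h]

theorem card_symmetricWords_odd (L b : ℕ) :
    ((symmetricWords (2 * L + 1) (2 * b + 1)).card : ℤ) = posPrefixCount L b := by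
  rw [posPrefixCount, Nat.cast_inj]
  symm
  refine Finset.card_bij' (fun z _ => dualWord z ++ 0 :: z) (fun w _ => w.drop (L + 1)) ?_ ?_ ?_ ?_
  · intro z hz
    obtain ⟨hz, hb, hp⟩ := Finset.mem_filter.1 hz
    obtain ⟨hl, hs⟩ := mem_smallWords.1 hz
    refine Finset.mem_filter.2 ⟨mem_smallWords.2
      ⟨?_, hs.dualWord_append (w := 0 :: z) ⟨hs, fun _ => hp⟩ ?_⟩, ?_, ?_⟩
    · rw [List.length_append, length_dualWord, List.length_cons]
      omega
    · simp [height]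
    · rw [List.count_append, count_zero_dualWord, List.count_cons_self]
      omega
    · rw [KTableau.dualWord_append, dualWord_dualWord]
      have : dualWord (0 :: z) = dualWord z ++ [0] := by simp [dualWord]
      rw [this]
      simp
  · intro w hw
    obtain ⟨hw, hk, hd⟩ := Finset.mem_filter.1 hw
    obtain ⟨hl, hs⟩ := mem_smallWords.1 hw
    have h := eq_dualWord_append_zero_cons hl hd
    rw [h] at hs
    have hs' := hs.of_append
    refine Finset.mem_filter.2 ⟨mem_smallWords.2 ⟨by simp; omega, hs'.1⟩, ?_, hs'.2 (by decide)⟩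
    rw [h, List.count_append, count_zero_dualWord, List.count_cons_self] at hk
    omega
  · intro z hz
    obtain ⟨hz, hb, hp⟩ := Finset.mem_filter.1 hz
    obtain ⟨hl, hs⟩ := mem_smallWords.1 hz
    have : dualWord z ++ 0 :: z = (dualWord z ++ [0]) ++ z := by simp
    rw [this]
    exact List.drop_left' (by simp [length_dualWord, hl])
  · intro w hw
    obtain ⟨hw, hk, hd⟩ := Finset.mem_filter.1 hw
    obtain ⟨hl, hs⟩ := mem_smallWords.1 hw
    exact (eq_dualWord_append_zero_cons hl hd).symm

/-! ### Increasing tableaux of shape `2 × n` -/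

theorem IncreasingTableau.ext_entry {μ : YoungDiagram} {S T : IncreasingTableau μ}
    (h : S.entry = T.entry) : S = T := by
  obtain ⟨⟨s, _, _, _⟩, _, _⟩ := S
  obtain ⟨⟨t, _, _, _⟩, _, _⟩ := T
  obtain rfl : s = t := h
  rfl

theorem IncreasingTableau.isTwoRow {n : ℕ} (hn : 1 ≤ n) (T : IncreasingTableau (rect 2 n)) :
    IsTwoRow n (maxEntry (rect 2 n) T.entry) T.entry := by
  obtain ⟨M, hM⟩ := T.entries_initial'
  have row : ∀ r < 2, ∀ c, c + 1 < n → T.entry r c < T.entry r (c + 1) :=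
    fun r hr c hc => T.row_strict' (Nat.lt_succ_self c) (mem_rect.2 ⟨hr, hc⟩)
  have col : ∀ c < n, T.entry 0 c < T.entry 1 c :=
    fun c hc => T.col_strict' (by norm_num) (mem_rect.2 ⟨by norm_num, hc⟩)
  have mem {r c : ℕ} (hr : r < 2) (hc : c < n) : T.entry r c ∈ Set.Icc 1 M := by
    rw [← hM]
    exact ⟨r, c, mem_rect.2 ⟨hr, hc⟩, rfl⟩
  have surj : ∀ v, 1 ≤ v → v ≤ M → ∃ c < n, T.entry 0 c = v ∨ T.entry 1 c = v := by
    intro v h1 hv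
    have : v ∈ Set.Icc 1 M := ⟨h1, hv⟩
    rw [← hM] at this
    obtain ⟨r, c, hrc, h⟩ := this
    obtain ⟨hr, hc⟩ := mem_rect.1 hrc
    obtain rfl | rfl : r = 0 ∨ r = 1 := by omega
    · exact ⟨c, hc, Or.inl h⟩
    · exact ⟨c, hc, Or.inr h⟩
  have last : T.entry 1 (n - 1) = M := by
    have hl := (mem (r := 1) (c := n - 1) (by norm_num) (by omega)).2
    refine le_antisymm hl ?_
    have h1 := (mem (r := 1) (c := n - 1) (by norm_num) (by omega)).1
    obtain ⟨c, hc, H⟩ := surj M (by omega) le_rfl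
    have h2 : T.entry 1 c ≤ T.entry 1 (n - 1) := by
      rcases (show c ≤ n - 1 by omega).eq_or_lt with rfl | h
      · exact le_rfl
      · exact (lt_of_step_lt (row 1 (by norm_num)) h (by omega)).le
    have h3 := col c hc
    omega
  have main : IsTwoRow n M T.entry :=
    ⟨hn, row, col, (mem (by norm_num) hn).1, last, surj⟩
  rwa [main.maxEntry_eq]

/-- The increasing tableau with the same entries as `T` in the first two rows and `n` columns. -/
def IsTwoRow.toTableau {n M : ℕ} {T : ℕ → ℕ → ℕ} (h : IsTwoRow n M T) :
    IncreasingTableau (rect 2 n) where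
  entry r c := if r < 2 ∧ c < n then T r c else 0
  row_weak' := by
    intro r c d hcd hd
    have := mem_rect.1 hd
    rw [if_pos this, if_pos (by omega)]
    exact h.row_le this.1 hcd.le this.2
  col_strict' := by
    intro r s c hrs hs
    have := mem_rect.1 hs
    obtain rfl : s = 1 := by omega
    obtain rfl : r = 0 := by omega
    rw [if_pos this, if_pos (by omega)]
    exact h.col c this.2
  zeros' := by
    intro r c hrc
    rw [mem_rect] at hrc
    rw [if_neg hrc]
  row_strict' := by
    intro r c d hcd hd
    have := mem_rect.1 hd
    rw [if_pos this, if_pos (by omega)]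
    exact h.row_lt this.1 hcd this.2
  entries_initial' := by
    refine ⟨M, Set.ext fun v => ⟨?_, ?_⟩⟩
    · rintro ⟨r, c, hrc, rfl⟩
      have := mem_rect.1 hrc
      rw [if_pos this]
      exact ⟨h.one_le_entry this.1 this.2, h.entry_le this.1 this.2⟩
    · rintro ⟨h1, h2⟩
      obtain ⟨c, hc, H | H⟩ := h.surj v h1 h2
      · exact ⟨0, c, mem_rect.2 ⟨by norm_num, hc⟩, by rw [if_pos ⟨by norm_num, hc⟩, H]⟩
      · exact ⟨1, c, mem_rect.2 ⟨by norm_num, hc⟩, by rw [if_pos ⟨by norm_num, hc⟩, H]⟩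

theorem IsTwoRow.toTableau_entry {n M : ℕ} {T : ℕ → ℕ → ℕ} (h : IsTwoRow n M T) {r c : ℕ}
    (hr : r < 2) (hc : c < n) : h.toTableau.entry r c = T r c :=
  if_pos ⟨hr, hc⟩

theorem maxEntry_congr {n : ℕ} {S T : ℕ → ℕ → ℕ} (h : ∀ r < 2, ∀ c < n, S r c = T r c) :
    maxEntry (rect 2 n) S = maxEntry (rect 2 n) T :=
  Finset.sup_congr rfl fun b hb => by
    have := mem_rect.1 ((YoungDiagram.mem_cells _).1 hb)
    exact h _ this.1 _ this.2

theorem IsTwoRow.maxEntry_toTableau {n M : ℕ} {T : ℕ → ℕ → ℕ} (h : IsTwoRow n M T) :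
    maxEntry (rect 2 n) h.toTableau.entry = M :=
  (maxEntry_congr fun _ hr _ hc => h.toTableau_entry hr hc).trans h.maxEntry_eq

theorem IncreasingTableau.ext_rect {n : ℕ} {S T : IncreasingTableau (rect 2 n)}
    (h : ∀ r < 2, ∀ c < n, S.entry r c = T.entry r c) : S = T := by
  refine IncreasingTableau.ext_entry (funext fun r => funext fun c => ?_)
  by_cases hrc : (r, c) ∈ rect 2 n
  · exact h r (mem_rect.1 hrc).1 c (mem_rect.1 hrc).2
  · rw [S.zeros' hrc, T.zeros' hrc]

/-! ### Rotation and complementation -/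

/-- Rotate a filling of the `2 × n` rectangle and complement its entries. -/
def rotate (n M : ℕ) (T : ℕ → ℕ → ℕ) (r c : ℕ) : ℕ := M + 1 - T (1 - r) (n - 1 - c)

theorem IsTwoRow.rotate {n M : ℕ} {T : ℕ → ℕ → ℕ} (h : IsTwoRow n M T) :
    IsTwoRow n M (rotate n M T) := by
  have hn := h.pos
  refine ⟨hn, ?_, ?_, ?_, ?_, ?_⟩
  · intro r hr c hc
    have := h.row_lt (r := 1 - r) (c := n - 1 - (c + 1)) (d := n - 1 - c) (by omega) (by omega)
      (by omega)
    have := h.entry_le (r := 1 - r) (c := n - 1 - c) (by omega) (by omega)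
    simp only [KTableau.rotate]
    omega
  · intro c hc
    have := h.col (n - 1 - c) (by omega)
    have := h.entry_le (r := 1) (c := n - 1 - c) (by omega) (by omega)
    simp only [KTableau.rotate, tsub_zero, tsub_self]
    omega
  · have := h.last
    simp only [KTableau.rotate, tsub_zero]
    omega
  · have := h.first
    simp only [KTableau.rotate, tsub_self]
    omega
  · intro v h1 hv
    obtain ⟨c, hc, H⟩ := h.surj (M + 1 - v) (by omega) (by omega)
    refine ⟨n - 1 - c, by omega, ?_⟩
    simp only [KTableau.rotate, tsub_zero, tsub_self]
    rw [show n - 1 - (n - 1 - c) = c by omega]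
    omega

theorem IsTwoRow.rotate_rotate {n M : ℕ} {T : ℕ → ℕ → ℕ} (h : IsTwoRow n M T) {r c : ℕ}
    (hr : r < 2) (hc : c < n) : KTableau.rotate n M (KTableau.rotate n M T) r c = T r c := by
  have := h.entry_le hr hc
  simp only [KTableau.rotate]
  rw [show 1 - (1 - r) = r by omega, show n - 1 - (n - 1 - c) = c by omega]
  omega

theorem IsTwoRow.rowCount_rotate {n M : ℕ} {T : ℕ → ℕ → ℕ} (h : IsTwoRow n M T) {r v : ℕ}
    (hr : r < 2) (hv : v ≤ M) :
    rowCount n (KTableau.rotate n M T r) v + rowCount n (T (1 - r)) (M - v) = n := by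
  have hle := rowCount_le n (T (1 - r)) (M - v)
  rw [rowCount_eq_of_iff (e := n - rowCount n (T (1 - r)) (M - v)) (by omega)]
  · omega
  · intro c hc
    have := h.le_iff (r := 1 - r) (c := n - 1 - c) (v := M - v) (by omega) (by omega)
    have := h.entry_le (r := 1 - r) (c := n - 1 - c) (by omega) (by omega)
    simp only [KTableau.rotate]
    omega

/-- An increasing tableau of shape `2 × n` has exactly one K-evacuation: rotate it and complement
its entries. -/
theorem isKEvacuation_iff {n : ℕ} (hn : 1 ≤ n) (T S : IncreasingTableau (rect 2 n)) :
    IsKEvacuation T S ↔ ∀ r < 2, ∀ c < n,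
      S.entry r c = rotate n (maxEntry (rect 2 n) T.entry) T.entry r c := by
  have h := T.isTwoRow hn
  generalize hM : maxEntry (rect 2 n) T.entry = M at h
  have key : ∀ j ≤ M, ∀ r < 2, ∀ c < n,
      (kPromotion (rect 2 n))^[M - j] T.entry r c ≤ j ↔ rotate n M T.entry r c ≤ j := by
    intro j hj r hr c hc
    have hp := h.iterate_kPromotion (M - j)
    rw [hp.le_iff hr hc, h.rotate.le_iff hr hc]
    have h1 := h.rowCount_iterate_kPromotion_sub (s := M - j) (by omega)
    have h2 := h.rowCount_rotate (v := j) hr hj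
    rw [show M - (M - j) = j by omega] at h1
    obtain rfl | rfl : r = 0 ∨ r = 1 := by omega
    · rw [tsub_zero] at h2
      omega
    · rw [tsub_self] at h2
      omega
  rw [IsKEvacuation, hM]
  constructor
  · intro H r hr c hc
    -- The chain gives information only for $j\le M$. Since the rotated entry is at most $M$,
    -- testing with it bounds the entry of $S$, and that entry can then be used as a test value too.
    have H' : ∀ j ≤ M, S.entry r c ≤ j ↔ rotate n M T.entry r c ≤ j := by
      intro j hj
      rw [← key j hj r hr c hc]
      have := Finset.ext_iff.1 (H j hj) (r, c)
      simpa [sublevel, hr, hc] using this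
    have hle := h.rotate.entry_le hr hc
    have h1 := (H' _ hle).2 le_rfl
    exact le_antisymm h1 ((H' _ (h1.trans hle)).1 le_rfl)
  · intro H j hj
    refine Finset.filter_congr fun b hb => ?_
    obtain ⟨hr, hc⟩ := mem_rect.1 ((YoungDiagram.mem_cells _).1 hb)
    rw [H _ hr _ hc, key j hj _ hr _ hc]

theorem Inc.isTwoRow {n k : ℕ} (hn : 1 ≤ n) (T : Inc (rect 2 n) k) :
    IsTwoRow n (2 * n - k) T.1.entry := by
  have h := T.1.isTwoRow hn
  have := T.2
  have := card_rect 2 n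
  rwa [show maxEntry (rect 2 n) T.1.entry = 2 * n - k by omega] at h

theorem Inc.le_two_mul {n k : ℕ} (T : Inc (rect 2 n) k) : k ≤ 2 * n := by
  have := T.2
  have := card_rect 2 n
  omega

/-- K-evacuation on increasing tableaux of shape `2 × n`. -/
def evacuate {n k : ℕ} (hn : 1 ≤ n) (T : Inc (rect 2 n) k) : Inc (rect 2 n) k :=
  ⟨(T.isTwoRow hn).rotate.toTableau, by
    rw [IsTwoRow.maxEntry_toTableau, card_rect]
    have := T.le_two_mul
    omega⟩

theorem evacuate_entry {n k : ℕ} (hn : 1 ≤ n) (T : Inc (rect 2 n) k) {r c : ℕ} (hr : r < 2)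
    (hc : c < n) : (evacuate hn T).1.entry r c = rotate n (2 * n - k) T.1.entry r c :=
  (T.isTwoRow hn).rotate.toTableau_entry hr hc

theorem Inc.ext_rect {n k : ℕ} {S T : Inc (rect 2 n) k}
    (h : ∀ r < 2, ∀ c < n, S.1.entry r c = T.1.entry r c) : S = T :=
  Subtype.ext (IncreasingTableau.ext_rect h)

theorem evacuate_evacuate {n k : ℕ} (hn : 1 ≤ n) (T : Inc (rect 2 n) k) :
    evacuate hn (evacuate hn T) = T := by
  refine Inc.ext_rect fun r hr c hc => ?_
  rw [evacuate_entry hn _ hr hc, ← (T.isTwoRow hn).rotate_rotate hr hc]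
  simp only [rotate]
  rw [evacuate_entry hn T (by omega) (by omega)]
  rfl

theorem isKEvacuation_iff_evacuate_eq {n k : ℕ} (hn : 1 ≤ n) (T S : Inc (rect 2 n) k) :
    IsKEvacuation T.1 S.1 ↔ evacuate hn T = S := by
  rw [isKEvacuation_iff hn, (T.isTwoRow hn).maxEntry_eq]
  constructor
  · intro h
    refine Inc.ext_rect fun r hr c hc => ?_
    rw [evacuate_entry hn T hr hc, h r hr c hc]
  · rintro rfl r hr c hc
    exact evacuate_entry hn T hr hc

/-! ### Tableaux as words -/

/-- The step of `v + 1`: `1` if it occurs in the upper row only, `-1` if in the lower row only, `0`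
if in both rows. -/
noncomputable def stepOf (n : ℕ) (T : ℕ → ℕ → ℕ) (v : ℕ) : SignType :=
  SignType.sign (((rowCount n (T 0) (v + 1) : ℤ) - rowCount n (T 0) v) -
    (rowCount n (T 1) (v + 1) - rowCount n (T 1) v))

/-- The word of the first `v` steps of `T`, the last one first. -/
noncomputable def tabWord (n : ℕ) (T : ℕ → ℕ → ℕ) : ℕ → List SignType
  | 0 => []
  | v + 1 => stepOf n T v :: tabWord n T v

theorem tabWord_eq (n : ℕ) (T : ℕ → ℕ → ℕ) (v : ℕ) :
    tabWord n T v = ((List.range v).map (stepOf n T)).reverse := by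
  induction v with
  | zero => rfl
  | succ v ih => rw [tabWord, ih, List.range_succ]; simp

theorem length_tabWord (n : ℕ) (T : ℕ → ℕ → ℕ) (v : ℕ) : (tabWord n T v).length = v := by
  simp [tabWord_eq]

namespace IsTwoRow

variable {n M : ℕ} {S T : ℕ → ℕ → ℕ}

theorem stepOf_cases (h : IsTwoRow n M T) {v : ℕ} (hv : v < M) :
    (stepOf n T v = 1 ∧ rowCount n (T 0) (v + 1) = rowCount n (T 0) v + 1 ∧
        rowCount n (T 1) (v + 1) = rowCount n (T 1) v) ∨
    (stepOf n T v = -1 ∧ rowCount n (T 0) (v + 1) = rowCount n (T 0) v ∧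
        rowCount n (T 1) (v + 1) = rowCount n (T 1) v + 1) ∨
    (stepOf n T v = 0 ∧ rowCount n (T 0) (v + 1) = rowCount n (T 0) v + 1 ∧
        rowCount n (T 1) (v + 1) = rowCount n (T 1) v + 1) := by
  have := h.isStepPair v hv
  simp only at this
  norm_cast at this
  rcases this with ⟨h0, h1⟩ | ⟨h0, h1⟩ | ⟨h0, h1⟩
  · left
    refine ⟨?_, h0, h1⟩
    rw [stepOf, h0, h1]
    simp
  · right; left
    refine ⟨?_, h0, h1⟩
    rw [stepOf, h0, h1]
    simp
  · right; right
    refine ⟨?_, h0, h1⟩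
    rw [stepOf, h0, h1]
    simp

/-- The height is the difference of the two row counts, and length plus number of zeros is their
sum; together they recover both counts from the word. -/
theorem tabWord_spec (h : IsTwoRow n M T) {v : ℕ} (hv : v ≤ M) :
    IsSmall (tabWord n T v) ∧
      height (tabWord n T v) = rowCount n (T 0) v - rowCount n (T 1) v ∧
      v + (tabWord n T v).count 0 = rowCount n (T 0) v + rowCount n (T 1) v := by
  induction v with
  | zero =>
    simp [tabWord, IsSmall, height, h.rowCount_zero (r := 0) (by norm_num),
      h.rowCount_zero (r := 1) (by norm_num)]
  | succ v ih =>
    obtain ⟨h1, h2, h3⟩ := ih (by omega)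
    have hcol := h.rowCount_one_succ_le v
    rcases h.stepOf_cases hv with ⟨e, e0, e1⟩ | ⟨e, e0, e1⟩ | ⟨e, e0, e1⟩
    · rw [tabWord, e, IsSmall, height, List.count_cons, if_neg (by decide)]
      refine ⟨⟨h1, fun H => absurd rfl H⟩, ?_, by omega⟩
      rw [h2, e0, e1]
      rw [SignType.coe_one]
      push_cast
      ring
    · rw [tabWord, e, IsSmall, height, List.count_cons, if_neg (by decide)]
      refine ⟨⟨h1, fun _ => by omega⟩, ?_, by omega⟩
      rw [h2, e0, e1]
      rw [SignType.coe_neg_one]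
      push_cast
      ring
    · rw [tabWord, e, IsSmall, height, List.count_cons, if_pos (by decide)]
      refine ⟨⟨h1, fun _ => by omega⟩, ?_, by omega⟩
      rw [h2, e0, e1]
      rw [SignType.coe_zero]
      push_cast
      ring

theorem height_tabWord (h : IsTwoRow n M T) : height (tabWord n T M) = 0 := by
  rw [(h.tabWord_spec le_rfl).2.1, h.rowCount_max (by norm_num), h.rowCount_max (by norm_num),
    sub_self]

theorem count_zero_tabWord (h : IsTwoRow n M T) : M + (tabWord n T M).count 0 = 2 * n := by
  rw [(h.tabWord_spec le_rfl).2.2, h.rowCount_max (by norm_num), h.rowCount_max (by norm_num),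
    two_mul]

theorem eq_of_rowCount_eq (hS : IsTwoRow n M S) (hT : IsTwoRow n M T)
    (H : ∀ v ≤ M, ∀ r < 2, rowCount n (S r) v = rowCount n (T r) v) {r c : ℕ} (hr : r < 2)
    (hc : c < n) : S r c = T r c := by
  have key : ∀ v ≤ M, S r c ≤ v ↔ T r c ≤ v := by
    intro v hv
    rw [hS.le_iff hr hc, hT.le_iff hr hc, H v hv r hr]
  exact le_antisymm ((key _ (hT.entry_le hr hc)).2 le_rfl) ((key _ (hS.entry_le hr hc)).1 le_rfl)

theorem eq_of_tabWord_eq (hS : IsTwoRow n M S) (hT : IsTwoRow n M T)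
    (H : tabWord n S M = tabWord n T M) {r c : ℕ} (hr : r < 2) (hc : c < n) : S r c = T r c := by
  have key : ∀ d ≤ M, tabWord n S (M - d) = tabWord n T (M - d) := by
    intro d hd
    induction d with
    | zero => exact H
    | succ d ih =>
      have := ih (by omega)
      rw [show M - d = M - (d + 1) + 1 by omega, tabWord, tabWord] at this
      exact (List.cons.inj this).2
  refine hS.eq_of_rowCount_eq hT (fun v hv r hr => ?_) hr hc
  have e := key (M - v) (by omega)
  rw [show M - (M - v) = v by omega] at e
  obtain ⟨-, s1, s2⟩ := hS.tabWord_spec hv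
  obtain ⟨-, t1, t2⟩ := hT.tabWord_spec hv
  rw [e] at s1 s2
  obtain rfl | rfl : r = 0 ∨ r = 1 := by omega
  all_goals omega

theorem stepOf_rotate (h : IsTwoRow n M T) {v : ℕ} (hv : v < M) :
    stepOf n (KTableau.rotate n M T) v = -stepOf n T (M - 1 - v) := by
  have a0 := h.rowCount_rotate (r := 0) (v := v) (by norm_num) hv.le
  have a1 := h.rowCount_rotate (r := 1) (v := v) (by norm_num) hv.le
  have b0 := h.rowCount_rotate (r := 0) (v := v + 1) (by norm_num) hv
  have b1 := h.rowCount_rotate (r := 1) (v := v + 1) (by norm_num) hv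
  simp only [tsub_zero, tsub_self] at a0 a1 b0 b1
  rw [show M - (v + 1) = M - 1 - v by omega] at b0 b1
  rw [stepOf, stepOf, show M - 1 - v + 1 = M - v by omega, ← Left.sign_neg]
  congr 1
  omega

theorem tabWord_rotate (h : IsTwoRow n M T) :
    tabWord n (KTableau.rotate n M T) M = dualWord (tabWord n T M) := by
  rw [dualWord, tabWord_eq, tabWord_eq]
  congr 1
  refine List.ext_getElem (by simp) fun v hv _ => ?_
  simp only [List.length_map, List.length_range] at hv
  simp [h.stepOf_rotate hv]

end IsTwoRow

/-! ### From words to tableaux -/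

/-- The number of letters different from `e`. -/
def countNe (e : SignType) (w : List SignType) : ℕ := w.countP (· ≠ e)

theorem countNe_cons (e x : SignType) (w : List SignType) :
    countNe e (x :: w) = countNe e w + if x = e then 0 else 1 := by
  rw [countNe, List.countP_cons, countNe]
  by_cases hx : x = e <;> simp [hx]

theorem height_eq_countNe (w : List SignType) : height w = countNe (-1) w - countNe 1 w := by
  induction w with
  | nil => rfl
  | cons x w ih =>
    rw [height, ih, countNe_cons, countNe_cons]
    cases x <;> simp <;> ring

theorem length_add_count_zero (w : List SignType) :
    w.length + w.count 0 = countNe (-1) w + countNe 1 w := by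
  induction w with
  | nil => rfl
  | cons x w ih =>
    rw [List.length_cons, List.count_cons, countNe_cons, countNe_cons]
    cases x <;> simp <;> omega

/-- The number of letters different from `e` among the first `v` letters of `w`, which is read from
right to left. -/
def prefixNe (e : SignType) (w : List SignType) (v : ℕ) : ℕ := countNe e (w.drop (w.length - v))

/-- The position of the `(c + 1)`-st letter of `w` that differs from `e`. -/
noncomputable def posNe (e : SignType) (w : List SignType) (c : ℕ) : ℕ :=
  sInf {v | c < prefixNe e w v}

theorem drop_length_sub_succ {w : List SignType} {v : ℕ} (hv : v < w.length) :
    ∃ x, w.drop (w.length - (v + 1)) = x :: w.drop (w.length - v) :=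
  ⟨w[w.length - (v + 1)], by
    rw [List.drop_eq_getElem_cons (by omega), show w.length - (v + 1) + 1 = w.length - v by omega]⟩

theorem prefixNe_succ (e : SignType) {w : List SignType} {v : ℕ} {x : SignType}
    (h : w.drop (w.length - (v + 1)) = x :: w.drop (w.length - v)) :
    prefixNe e w (v + 1) = prefixNe e w v + if x = e then 0 else 1 := by
  rw [prefixNe, h, prefixNe, countNe_cons]

theorem prefixNe_zero (e : SignType) (w : List SignType) : prefixNe e w 0 = 0 := by
  simp [prefixNe, countNe]

theorem prefixNe_length (e : SignType) (w : List SignType) :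
    prefixNe e w w.length = countNe e w := by
  simp [prefixNe]

theorem prefixNe_mono (e : SignType) (w : List SignType) : Monotone (prefixNe e w) := by
  intro u v huv
  rw [prefixNe, prefixNe, countNe, countNe]
  exact (List.drop_sublist_drop_left w (by omega)).countP_le

theorem posNe_le_iff {e : SignType} {w : List SignType} {c v : ℕ} (hc : c < countNe e w) :
    posNe e w c ≤ v ↔ c < prefixNe e w v := by
  have hne : {v | c < prefixNe e w v}.Nonempty :=
    ⟨w.length, show c < prefixNe e w w.length by rwa [prefixNe_length]⟩
  constructor
  · intro h
    exact (Nat.sInf_mem hne).trans_le (prefixNe_mono e w h)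
  · intro h
    exact Nat.sInf_le h

theorem posNe_spec {e : SignType} {w : List SignType} {c : ℕ} (hc : c < countNe e w) :
    ∃ v < w.length, posNe e w c = v + 1 ∧ prefixNe e w v = c ∧ prefixNe e w (v + 1) = c + 1 := by
  have h1 := (posNe_le_iff (v := posNe e w c) hc).1 le_rfl
  have hl := (posNe_le_iff (v := w.length) hc).2 (by rwa [prefixNe_length])
  have h0 : posNe e w c ≠ 0 := by
    intro h
    rw [h, prefixNe_zero] at h1
    omega
  obtain ⟨v, hv⟩ := Nat.exists_eq_succ_of_ne_zero h0
  have h2 := mt (posNe_le_iff (v := v) hc).2 (by omega)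
  obtain ⟨x, hx⟩ := drop_length_sub_succ (w := w) (v := v) (by omega)
  have h3 := prefixNe_succ e hx
  rw [hv] at h1
  refine ⟨v, by omega, hv, ?_⟩
  split_ifs at h3 <;> simp only [Nat.succ_eq_add_one] at * <;> omega

theorem posNe_eq {e : SignType} {w : List SignType} {v : ℕ}
    (h : prefixNe e w (v + 1) = prefixNe e w v + 1) (hv : prefixNe e w v < countNe e w) :
    posNe e w (prefixNe e w v) = v + 1 := by
  refine le_antisymm ((posNe_le_iff hv).2 (by omega)) ?_
  by_contra! H
  exact absurd ((posNe_le_iff (v := v) hv).1 (by omega)) (lt_irrefl _)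

/-- The filling whose rows list the positions of the letters `1`, `0`, and `0`, `-1`. -/
noncomputable def wordTab (w : List SignType) (r c : ℕ) : ℕ :=
  if r = 0 then posNe (-1) w c else posNe 1 w c

/-- The final height and the number of zeros give each row $n$ entries. Smallness at a step that
raises the lower count, recorded in `mid`, is what makes the columns strict. -/
theorem IsSmall.isTwoRow_wordTab {n M : ℕ} {w : List SignType} (hn : 1 ≤ n) (hw : IsSmall w)
    (hl : w.length = M) (h0 : height w = 0) (hM : M + w.count 0 = 2 * n) :
    countNe (-1) w = n ∧ countNe 1 w = n ∧ IsTwoRow n M (wordTab w) := by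
  have e1 := height_eq_countNe w
  have e2 := length_add_count_zero w
  have c0 : countNe (-1) w = n := by omega
  have c1 : countNe 1 w = n := by omega
  have strict (e : SignType) (he : countNe e w = n) (c : ℕ) (hc : c + 1 < n) :
      posNe e w c < posNe e w (c + 1) := by
    obtain ⟨v, hv, p1, p2, p3⟩ := posNe_spec (e := e) (w := w) (c := c + 1) (by omega)
    rw [p1, Nat.lt_succ_iff, posNe_le_iff (by omega)]
    omega
  have mid (v : ℕ) (hv : v < M) : prefixNe 1 w (v + 1) ≤ prefixNe (-1) w v := by
    obtain ⟨x, hx⟩ := drop_length_sub_succ (w := w) (v := v) (by omega)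
    have h3 := prefixNe_succ 1 hx
    have hs : IsSmall (x :: w.drop (w.length - v)) := by
      rw [← hx]
      refine IsSmall.of_append (u := w.take (w.length - (v + 1))) ?_
      rwa [List.take_append_drop]
    have hh := height_eq_countNe (w.drop (w.length - v))
    rw [← prefixNe, ← prefixNe] at hh
    have := hs.1.height_nonneg
    have := hs.2
    split_ifs at h3 with hx1
    · omega
    · have := hs.2 hx1
      omega
  refine ⟨c0, c1, hn, ?_, ?_, ?_, ?_, ?_⟩
  · intro r hr c hc
    obtain rfl | rfl : r = 0 ∨ r = 1 := by omega
    · exact strict _ c0 c hc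
    · exact strict _ c1 c hc
  · intro c hc
    obtain ⟨v, hv, p1, p2, p3⟩ := posNe_spec (e := 1) (w := w) (c := c) (by omega)
    change posNe (-1) w c < posNe 1 w c
    rw [p1, Nat.lt_succ_iff, posNe_le_iff (by omega)]
    have := mid v (by omega)
    omega
  · obtain ⟨v, hv, p1, -⟩ := posNe_spec (e := -1) (w := w) (c := 0) (by omega)
    change 1 ≤ posNe (-1) w 0
    omega
  · change posNe 1 w (n - 1) = M
    have hMpos : 0 < M := by
      by_contra! H
      obtain rfl : w = [] := List.length_eq_zero_iff.1 (by omega)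
      simp [countNe] at c0
      omega
    have hm := mid (M - 1) (by omega)
    obtain ⟨x, hx⟩ := drop_length_sub_succ (w := w) (v := M - 1) (by omega)
    have h3 := prefixNe_succ (-1) hx
    have h4 := prefixNe_succ 1 hx
    rw [show M - 1 + 1 = w.length by omega] at h3 h4 hm
    rw [prefixNe_length] at h3 h4 hm
    -- By `mid` all $n$ letters of the upper row occur before the last step, so that step belongs to
    -- the lower row only.
    have hx1 : x = -1 := by
      by_contra hx1
      rw [if_neg hx1] at h3
      omega
    rw [hx1, if_neg (by decide)] at h4
    have := posNe_eq (e := 1) (w := w) (v := M - 1)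
      (by rw [show M - 1 + 1 = w.length by omega, prefixNe_length]; exact h4) (by omega)
    rw [show prefixNe 1 w (M - 1) = n - 1 by omega] at this
    omega
  · intro v h1 hv
    obtain ⟨v, rfl⟩ : ∃ u, v = u + 1 := ⟨v - 1, by omega⟩
    obtain ⟨x, hx⟩ := drop_length_sub_succ (w := w) (v := v) (by omega)
    have bound (e : SignType) : prefixNe e w (v + 1) ≤ countNe e w := by
      rw [← prefixNe_length]
      exact prefixNe_mono e w (by omega)
    by_cases hx1 : x = 1
    · have h3 := prefixNe_succ (-1) hx
      rw [hx1, if_neg (by decide)] at h3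
      have := bound (-1)
      exact ⟨prefixNe (-1) w v, by omega, Or.inl (posNe_eq h3 (by omega))⟩
    · have h3 := prefixNe_succ 1 hx
      rw [if_neg hx1] at h3
      have := bound 1
      exact ⟨prefixNe 1 w v, by omega, Or.inr (posNe_eq h3 (by omega))⟩

theorem IsSmall.tabWord_wordTab {n M : ℕ} {w : List SignType} (hn : 1 ≤ n) (hw : IsSmall w)
    (hl : w.length = M) (h0 : height w = 0) (hM : M + w.count 0 = 2 * n) :
    tabWord n (wordTab w) M = w := by
  obtain ⟨c0, c1, h⟩ := hw.isTwoRow_wordTab hn hl h0 hM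
  have r0 (v : ℕ) (hv : v ≤ M) : rowCount n (wordTab w 0) v = prefixNe (-1) w v := by
    refine rowCount_eq_of_iff ?_ fun c hc => posNe_le_iff (by omega)
    rw [← c0, ← prefixNe_length]
    exact prefixNe_mono _ w (by omega)
  have r1 (v : ℕ) (hv : v ≤ M) : rowCount n (wordTab w 1) v = prefixNe 1 w v := by
    refine rowCount_eq_of_iff ?_ fun c hc => posNe_le_iff (by omega)
    rw [← c1, ← prefixNe_length]
    exact prefixNe_mono _ w (by omega)
  have key : ∀ v ≤ M, tabWord n (wordTab w) v = w.drop (w.length - v) := by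
    intro v hv
    induction v with
    | zero => simp [tabWord]
    | succ v ih =>
      obtain ⟨x, hx⟩ := drop_length_sub_succ (w := w) (v := v) (by omega)
      rw [tabWord, ih (by omega), hx, stepOf, r0 _ hv, r0 _ (by omega), r1 _ hv, r1 _ (by omega),
        prefixNe_succ _ hx, prefixNe_succ _ hx]
      congr 1
      cases x <;> simp
  rw [key M le_rfl, hl, Nat.sub_self, List.drop_zero]

/-! ### Counting tableaux -/

theorem rowCount_congr {n : ℕ} {x y : ℕ → ℕ} (h : ∀ c < n, x c = y c) (v : ℕ) :
    rowCount n x v = rowCount n y v := by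
  rw [rowCount, rowCount]
  congr 1
  refine Finset.filter_congr fun c hc => ?_
  rw [h c (Finset.mem_range.1 hc)]

theorem tabWord_congr {n : ℕ} {S T : ℕ → ℕ → ℕ} (h : ∀ r < 2, ∀ c < n, S r c = T r c) (v : ℕ) :
    tabWord n S v = tabWord n T v := by
  have : stepOf n S = stepOf n T := by
    funext v
    rw [stepOf, stepOf]
    simp only [rowCount_congr (h 0 (by norm_num)), rowCount_congr (h 1 (by norm_num))]
  rw [tabWord_eq, tabWord_eq, this]

/-- The word of an increasing tableau of shape `2 × n`. -/
noncomputable def Inc.word {n k : ℕ} (T : Inc (rect 2 n) k) : List SignType :=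
  tabWord n T.1.entry (2 * n - k)

theorem Inc.word_injective {n k : ℕ} (hn : 1 ≤ n) :
    Function.Injective (Inc.word : Inc (rect 2 n) k → List SignType) := fun S T h =>
  Inc.ext_rect fun _ hr _ hc => (S.isTwoRow hn).eq_of_tabWord_eq (T.isTwoRow hn) h hr hc

theorem exists_word_eq_iff {n k : ℕ} (hn : 1 ≤ n) (hk : k ≤ 2 * n) (w : List SignType) :
    (∃ T : Inc (rect 2 n) k, T.word = w) ↔
      w ∈ (smallWords (2 * n - k)).filter fun w => (w.count 0 : ℤ) = k ∧ height w = 0 := by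
  rw [Finset.mem_filter, mem_smallWords]
  constructor
  · rintro ⟨T, rfl⟩
    have h := T.isTwoRow hn
    have := h.count_zero_tabWord
    refine ⟨⟨length_tabWord _ _ _, (h.tabWord_spec le_rfl).1⟩, ?_, h.height_tabWord⟩
    rw [Inc.word]
    omega
  · rintro ⟨⟨hl, hs⟩, hc, h0⟩
    obtain ⟨-, -, h⟩ := hs.isTwoRow_wordTab hn hl h0 (by omega)
    refine ⟨⟨h.toTableau, ?_⟩, ?_⟩
    · rw [h.maxEntry_toTableau, card_rect]
      omega
    · exact (tabWord_congr (fun r hr c hc => h.toTableau_entry hr hc) _).trans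
        (hs.tabWord_wordTab hn hl h0 (by omega))

theorem Inc.word_evacuate {n k : ℕ} (hn : 1 ≤ n) (T : Inc (rect 2 n) k) :
    (evacuate hn T).word = dualWord T.word := by
  rw [Inc.word, Inc.word, ← (T.isTwoRow hn).tabWord_rotate]
  exact tabWord_congr (fun r hr c hc => evacuate_entry hn T hr hc) _

theorem natCard_eq_card_of_injective {α β : Type*} {f : α → β} (hf : Function.Injective f)
    {s : Finset β} (h : ∀ b, (∃ a, f a = b) ↔ b ∈ s) : Nat.card α = s.card := by
  have : Set.range f = s := Set.ext fun b => h b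
  rw [← Nat.card_range_of_injective hf, this]
  simp

/-- The last upper entry is at least $n$ and the entry below it at least $n+1$, so $2n-k\ge n+1$.
For $k\ge n$ the set is empty, in agreement with $f=0$. -/
theorem Inc.lt_of_nonempty {n k : ℕ} (hn : 1 ≤ n) (T : Inc (rect 2 n) k) : k < n := by
  have h := T.isTwoRow hn
  have key : ∀ c < n, c + 1 ≤ T.1.entry 0 c := by
    intro c hc
    induction c with
    | zero => exact h.one_le
    | succ c ih =>
      have := ih (by omega)
      have := h.row 0 (by norm_num) c hc
      omega
  have h1 := key (n - 1) (by omega)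
  have h2 := h.col (n - 1) (by omega)
  have h3 := h.last
  omega

theorem Inc.finite {n k : ℕ} (hn : 1 ≤ n) : Finite (Inc (rect 2 n) k) := by
  rcases le_or_gt n k with h | h
  · have : IsEmpty (Inc (rect 2 n) k) := ⟨fun T => absurd (T.lt_of_nonempty hn) (by omega)⟩
    infer_instance
  · refine Finite.of_injective (fun T : Inc (rect 2 n) k =>
      (⟨T.word, (exists_word_eq_iff hn (by omega) _).1 ⟨T, rfl⟩⟩ :
        (smallWords (2 * n - k)).filter fun w => (w.count 0 : ℤ) = k ∧ height w = 0))
      fun S T hST => Inc.word_injective hn (congrArg Subtype.val hST)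

theorem card_inc {n k : ℕ} (hn : 1 ≤ n) :
    (Nat.card (Inc (rect 2 n) k) : ℤ) = (sievingPoly n k).eval 1 := by
  rcases le_or_gt n k with h | h
  · have : IsEmpty (Inc (rect 2 n) k) := ⟨fun T => absurd (T.lt_of_nonempty hn) (by omega)⟩
    rw [sievingPoly_eq_zero hn h]
    simp
  · rw [← smallCount_eq_eval_one h, smallCount, natCard_eq_card_of_injective
      (Inc.word_injective hn) (exists_word_eq_iff hn (by omega))]

theorem card_symmetricWords {n k : ℕ} (h : k < n) :
    ((symmetricWords (2 * n - k) k).card : ℤ) = (sievingPoly n k).eval (-1) := by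
  obtain ⟨b, rfl | rfl⟩ := k.even_or_odd'
  · rw [← prefixCount_eq_eval_neg_one h, ← card_symmetricWords_even,
      show 2 * n - 2 * b = 2 * (n - b) by omega]
  · rw [← posPrefixCount_eq_eval_neg_one h, ← card_symmetricWords_odd,
      show 2 * n - (2 * b + 1) = 2 * (n - 1 - b) + 1 by omega]

theorem card_evacuate_eq_self {n k : ℕ} (hn : 1 ≤ n) :
    (Nat.card {T : Inc (rect 2 n) k // evacuate hn T = T} : ℤ) = (sievingPoly n k).eval (-1) := by
  rcases le_or_gt n k with h | h
  · have : IsEmpty (Inc (rect 2 n) k) := ⟨fun T => absurd (T.lt_of_nonempty hn) (by omega)⟩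
    rw [sievingPoly_eq_zero hn h]
    simp
  · rw [← card_symmetricWords h, natCard_eq_card_of_injective
      (f := fun T : {T : Inc (rect 2 n) k // evacuate hn T = T} => T.1.word)
      ((Inc.word_injective hn).comp Subtype.val_injective)]
    intro w
    rw [symmetricWords, Finset.mem_filter]
    constructor
    · rintro ⟨T, rfl⟩
      have hw := Finset.mem_filter.1 ((exists_word_eq_iff hn (by omega) _).1 ⟨T.1, rfl⟩)
      refine ⟨hw.1, by exact_mod_cast hw.2.1, ?_⟩
      rw [← Inc.word_evacuate hn, T.2]
    · rintro ⟨hw, hk, hd⟩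
      -- A self-dual word has height equal to its negative, so it ends at $0$; this is why
      -- `symmetricWords` imposes no final height.
      have h0 := height_dualWord w
      rw [hd] at h0
      obtain ⟨T, rfl⟩ := (exists_word_eq_iff hn (by omega) w).2
        (Finset.mem_filter.2 ⟨hw, by exact_mod_cast hk, by omega⟩)
      exact ⟨⟨T, Inc.word_injective hn (by rw [Inc.word_evacuate, hd])⟩, rfl⟩

/-! ### The cyclic action -/

theorem zmod_two_eq (a : ZMod 2) : a = 0 ∨ a = 1 := by
  revert a; decide

/-- The action of the cyclic group of order two generated by an involution. -/
@[reducible] def involutionAction {X : Type*} {e : X → X} (he : Function.Involutive e) :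
    MulAction (Multiplicative (ZMod 2)) X where
  smul g x := if g.toAdd = 0 then x else e x
  one_smul x := if_pos rfl
  mul_smul g h x := by
    change (if (g * h).toAdd = 0 then x else e x) =
      if g.toAdd = 0 then (if h.toAdd = 0 then x else e x) else
        e (if h.toAdd = 0 then x else e x)
    rw [toAdd_mul]
    rcases zmod_two_eq g.toAdd with hg | hg <;> rcases zmod_two_eq h.toAdd with hh | hh <;>
      rw [hg, hh]
    · simp
    · simp
    · simp
    · rw [if_pos (by decide), if_neg (by decide), if_neg (by decide), he]

/-- For a group of order two the phenomenon reduces to two values: the only primitive root is $-1$,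
and $c^m$ acts trivially or by the involution according to the parity of $m$. -/
theorem hasCyclicSieving_involution {X : Type*} [Finite X] {e : X → X}
    (he : Function.Involutive e) {f : ℤ[X]} (h1 : (Nat.card X : ℤ) = f.eval 1)
    (h2 : (Nat.card {x // e x = x} : ℤ) = f.eval (-1)) :
    let := involutionAction he
    HasCyclicSieving X (Multiplicative.ofAdd (1 : ZMod 2)) f := by
  let := involutionAction he
  have hc (x : X) : Multiplicative.ofAdd (1 : ZMod 2) • x = e x := if_neg (by decide)
  have hsq : Multiplicative.ofAdd (1 : ZMod 2) ^ (2 : ℤ) = 1 := by decide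
  refine ⟨inferInstance, inferInstance, fun g => ?_, fun m ζ hζ => ?_⟩
  · rcases zmod_two_eq g.toAdd with hg | hg
    · exact Subgroup.mem_zpowers_iff.2 ⟨0, by rw [zpow_zero]; exact hg.symm⟩
    · exact Subgroup.mem_zpowers_iff.2 ⟨1, by rw [zpow_one]; exact hg.symm⟩
  · rw [show Nat.card (Multiplicative (ZMod 2)) = 2 by simp] at hζ
    obtain rfl := hζ.eq_neg_one_of_two_right
    obtain ⟨j, rfl | rfl⟩ := m.even_or_odd'
    · have e1 : (-1 : ℂ) ^ (2 * j) = algebraMap ℤ ℂ 1 := by simp [zpow_mul]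
      rw [zpow_mul, hsq, one_zpow, e1, aeval_algebraMap_apply_eq_algebraMap_eval, ← h1,
        MulAction.fixedBy_one_eq_univ]
      simp
    · have e1 : (-1 : ℂ) ^ (2 * j + 1) = algebraMap ℤ ℂ (-1) := by
        rw [zpow_add₀ (by norm_num), zpow_mul]; simp
      rw [zpow_add, zpow_mul, hsq, one_zpow, one_mul, zpow_one, e1,
        aeval_algebraMap_apply_eq_algebraMap_eval, ← h2]
      have : Nat.card (MulAction.fixedBy X (Multiplicative.ofAdd (1 : ZMod 2))) =
          Nat.card {x // e x = x} :=
        Nat.card_congr (Equiv.subtypeEquivRight fun x => by rw [MulAction.mem_fixedBy, hc])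
      rw [this]
      simp

end KTableau

theorem theorem1p2 (n k : ℕ) (hn : 1 ≤ n) :
    KTableau.sievingPoly n k * KTableau.qInt (n - k) =
        KTableau.qBinom (n - 1) k * KTableau.qBinom (2 * n - k) (n - k - 1) ∧
      (∃ _ : MulAction (Multiplicative (ZMod 2)) (KTableau.Inc (KTableau.rect 2 n) k),
        (∀ T : KTableau.Inc (KTableau.rect 2 n) k,
          KTableau.IsKEvacuation T.1 ((Multiplicative.ofAdd (1 : ZMod 2)) • T).1) ∧
        KTableau.HasCyclicSieving (KTableau.Inc (KTableau.rect 2 n) k)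
          (Multiplicative.ofAdd (1 : ZMod 2)) (KTableau.sievingPoly n k)) ∧
      (Nat.card {T : KTableau.Inc (KTableau.rect 2 n) k // KTableau.IsKEvacuation T.1 T.1} : ℤ) =
        (KTableau.sievingPoly n k).eval (-1) := by
  have := KTableau.Inc.finite (k := k) hn
  have he : Function.Involutive (KTableau.evacuate (k := k) hn) := KTableau.evacuate_evacuate hn
  refine ⟨KTableau.sievingPoly_mul_qInt n k hn, ⟨KTableau.involutionAction he, fun T => ?_,
    KTableau.hasCyclicSieving_involution he (KTableau.card_inc hn)
      (KTableau.card_evacuate_eq_self hn)⟩, ?_⟩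
  -- K-evacuation as a relation is the graph of `evacuate`, and the generator acts by it since $1\ne
  -- 0$ in `ZMod 2`.
  · rw [KTableau.isKEvacuation_iff_evacuate_eq hn]
    exact (if_neg (by decide)).symm
  · rw [← KTableau.card_evacuate_eq_self hn]
    simp only [KTableau.isKEvacuation_iff_evacuate_eq hn]
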